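/- Let $(R,\mathfrak m)$ be a Cohen–Macaulay local ring (in particular Noetherian) of dimension $d>0$ with infinite residue field. Let $I$ be an $\mathfrak m$-primary ideal of $R$, and let $J$ be a minimal reduction of $I$; that is, $J$ is minimal with respect to inclusion among the ideals $J'\subseteq I$ with $I^{r+1}=J'I^{r}$ for some $r\ge 0$. Suppose that $\lambda(I^{n+1}/JI^{n})=1$ for some $n\ge 1$, where $\lambda$ denotes length as an $R$-module. Then the $R$-module $V=\bigl(I+(J:I^{n})\bigr)/(J:I^{n})$ is annihilated by $\mathfrak m$, hence is a vector space over $R/\mathfrak m$. If (a) $J\cap I^{k}=JI^{k-1}$ for all $k=1,\dots,n$, and (b) $\dim_{R/\mathfrak m}V\ge 2$, then the associated graded ring $\mathrm{gr}_I(R)=\bigoplus_{k\ge 0}I^{k}/I^{k+1}$ is Cohen–Macaulay, i.e. it is Noetherian and each of its localizations at a maximal ideal is a Cohen–Macaulay local ring. -/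

import Mathlib

open Polynomial IsLocalRing

universe u

namespace SallyModule

/-- The depth of a local ring: the supremum of the lengths of the `R`-regular sequences
consisting of elements of the maximal ideal. -/
noncomputable def localDepth (R : Type u) [CommRing R] [IsLocalRing R] : ℕ∞ :=
  ⨆ rs : {rs : List R // RingTheory.Sequence.IsRegular R rs ∧ ∀ r ∈ rs, r ∈ maximalIdeal R},
    (rs.1.length : ℕ∞)

/-- A Cohen–Macaulay local ring: a Noetherian local ring whose depth equals its Krull dimension. -/
structure IsCohenMacaulayLocalRing (R : Type u) [CommRing R] [IsLocalRing R] : Prop where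
  isNoetherianRing : IsNoetherianRing R
  depth_eq_dim : (localDepth R : WithBot ℕ∞) = ringKrullDim R

/-- A Cohen–Macaulay ring (not necessarily local): a Noetherian ring all of whose localizations at
maximal ideals are Cohen–Macaulay local rings. -/
structure IsCohenMacaulayRing (A : Type u) [CommRing A] : Prop where
  isNoetherianRing : IsNoetherianRing A
  localization : ∀ (M : Ideal A) [M.IsMaximal], IsCohenMacaulayLocalRing (Localization.AtPrime M)

/-- `I` is primary to the maximal ideal of the local ring `R`. -/
def IsMPrimary {R : Type u} [CommRing R] [IsLocalRing R] (I : Ideal R) : Prop :=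
  I.IsPrimary ∧ I.radical = maximalIdeal R

/-- `J` is a reduction of `I`: `J ⊆ I` and `I ^ (r + 1) = J * I ^ r` for some `r ≥ 0`. -/
def IsReduction {R : Type u} [CommRing R] (I J : Ideal R) : Prop :=
  J ≤ I ∧ ∃ r : ℕ, I ^ (r + 1) = J * I ^ r

/-- `J` is a minimal reduction of `I`: a reduction of `I` which is minimal with respect
to inclusion among the reductions of `I`. -/
def IsMinimalReduction {R : Type u} [CommRing R] (I J : Ideal R) : Prop :=
  Minimal (IsReduction I) J

/-- The ideal `⨁ₙ I ^ (n + 1) tⁿ` (that is, `I R[It]`) of the Rees algebra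
`R[It] = ⨁ₙ I ^ n tⁿ`. -/
def reesShift {R : Type u} [CommRing R] (I : Ideal R) : Ideal (reesAlgebra I) where
  carrier := {f | ∀ n, (f : R[X]).coeff n ∈ I ^ (n + 1)}
  add_mem' hf hg n := by
    simpa using add_mem (hf n) (hg n)
  zero_mem' n := by simp
  smul_mem' c f hf n := by
    simp only [smul_eq_mul, MulMemClass.coe_mul, coeff_mul]
    refine Ideal.sum_mem _ ?_
    rintro ⟨i, j⟩ e
    rw [← Finset.HasAntidiagonal.mem_antidiagonal.mp e, add_assoc, pow_add]
    exact Ideal.mul_mem_mul (c.2 i) (hf j)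

/-- The associated graded ring `gr_I(R) = ⨁ₙ I ^ n / I ^ (n + 1)`, as the quotient of
`R[It] = ⨁ₙ I ^ n tⁿ` by its ideal `⨁ₙ I ^ (n + 1) tⁿ`. -/
abbrev AssociatedGradedRing {R : Type u} [CommRing R] (I : Ideal R) : Type u :=
  reesAlgebra I ⧸ reesShift I

/-- The quotient `A / (A ∩ B)` as an `R`-module; this is `A / B` whenever `B ⊆ A`. -/
abbrev idealQuot {R : Type u} [CommRing R] (A B : Ideal R) : Type u :=
  A ⧸ B.submoduleOf A

/-- The `R`-module `V = (I + (J : I ^ n)) / (J : I ^ n)`. -/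
abbrev colonQuot {R : Type u} [CommRing R] (I J : Ideal R) (n : ℕ) : Type u :=
  idealQuot (I ⊔ J.colon (↑(I ^ n) : Set R)) (J.colon (↑(I ^ n) : Set R))

/-- If `I ^ (n + 1) / J I ^ n` has length one, the maximal ideal annihilates `V`. -/
theorem colonQuot_isTorsionBySet {R : Type u} [CommRing R] [IsLocalRing R] (I J : Ideal R) (n : ℕ)
    (h : Module.length R (idealQuot (I ^ (n + 1)) (J * I ^ n)) = 1) :
    Module.IsTorsionBySet R (colonQuot I J n) (maximalIdeal R) := by
  have hs : IsSimpleModule R (idealQuot (I ^ (n + 1)) (J * I ^ n)) := Module.length_eq_one_iff.mp h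
  have hann : Module.annihilator R (idealQuot (I ^ (n + 1)) (J * I ^ n)) = maximalIdeal R :=
    IsLocalRing.eq_maximalIdeal (IsSimpleModule.annihilator_isMaximal)
  have key : ∀ a ∈ maximalIdeal R, ∀ x ∈ I ^ (n + 1), a * x ∈ J := by
    intro a ha x hx
    rw [← hann, Module.mem_annihilator] at ha
    have h1 : ((J * I ^ n).submoduleOf (I ^ (n + 1))).mkQ (a • ⟨x, hx⟩) = 0 :=
      (map_smul _ a _).trans (ha _)
    rw [Submodule.mkQ_apply, Submodule.Quotient.mk_eq_zero] at h1
    have h2 : a * x ∈ J * I ^ n := Submodule.mem_comap.mp h1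
    exact Ideal.mul_le_left h2
  rintro v ⟨a, ha⟩
  induction v using Submodule.Quotient.induction_on with
  | H z =>
    obtain ⟨z, hz⟩ := z
    refine (map_smul (Submodule.mkQ _) a _).symm.trans ((Submodule.Quotient.mk_eq_zero _).mpr ?_)
    change a * z ∈ J.colon (↑(I ^ n) : Set R)
    obtain ⟨i, hi, c, hc, rfl⟩ := Submodule.mem_sup.mp hz
    rw [mul_add]
    refine add_mem (Submodule.mem_colon.mpr fun s hs' => ?_) (Ideal.mul_mem_left _ _ hc)
    rw [smul_eq_mul, mul_assoc]
    refine key a ha _ ?_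
    rw [pow_succ']
    exact Ideal.mul_mem_mul hi hs'

/-- The dimension of `V = (I + (J : I ^ n)) / (J : I ^ n)` as a vector space over the residue
field `R / 𝔪`; the scalar action is the one induced by that of `R`, which descends to `R / 𝔪`
because `I ^ (n + 1) / J I ^ n` has length one. -/
noncomputable def colonQuotDim {R : Type u} [CommRing R] [IsLocalRing R] (I J : Ideal R) (n : ℕ)
    (h : Module.length R (idealQuot (I ^ (n + 1)) (J * I ^ n)) = 1) : Cardinal.{u} :=
  letI : Module (ResidueField R) (colonQuot I J n) :=
    (colonQuot_isTorsionBySet I J n h).module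
  Module.rank (ResidueField R) (colonQuot I J n)

end SallyModule

/-! Since `I ^ (n + 1) / J I ^ n` has length one, multiplication pairs `I` and `I ^ n` into a
one-dimensional space. If `J ∩ I ^ (n + 1)` were larger than `J I ^ n`, then `I ^ (n + 1) ⊆ J` and
`V = 0`. As `dim V ≥ 2`, every `x ∈ I` has a partner `y ∈ I` independent of it, and some `u ∈ I ^ n`
has `x u ∈ J I ^ n` and `y u ∉ J I ^ n`. So `y u` generates `I ^ (n + 1)` modulo `J I ^ n`, and `x
(y u) = y (x u)` gives `I ^ (n + 2) = J I ^ (n + 1)`. With (a), the Valabrega–Valla condition `J ∩ I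
^ (k + 1) = J I ^ k` follows for all `k` (`inf_pow_succ_le`).

A minimal reduction needs at most `d` generators: otherwise the independence of the monomials in its
generators makes `λ(R / J ^ s)` grow faster than `s ^ d`. Since `R` is Cohen–Macaulay, these
generators form a regular sequence (`exists_isRegularFamily_of_isMinimalReduction`), and by
Valabrega–Valla so do their `ℓ` initial forms in `gr_I(R)`.

A maximal ideal `M` of `gr_I(R)` need not contain these initial forms. It does contain monic
polynomials of a common degree `e` in them, and the leading forms of these are the `e`-th powers of
the initial forms. A family with regular leading forms is regular
(`IsRegularFamily.of_leadingForms`), so the depth at `M` is at least `ℓ`. The dimension is at most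
`ℓ` because `gr_I(R)` is finite over a polynomial ring in `ℓ` variables over the Artinian ring `R /
I`. -/

namespace SallyModule

/-! ### The pairing into `I ^ (n + 1) / J I ^ n` and the Valabrega–Valla condition. -/

section Pairing

variable {R : Type u} [CommRing R] {I J : Ideal R} {n : ℕ}

/-- If `A / B` has length one, then `A` is generated modulo `B` by any element of `A` outside `B`. -/
theorem exists_smul_sub_mem_of_length_eq_one {A B : Ideal R}
    (h : Module.length R (idealQuot A B) = 1) {x y : R} (hx : x ∈ A) (hxB : x ∉ B) (hy : y ∈ A) :
    ∃ c : R, y - c * x ∈ B := by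
  have hs : IsSimpleModule R (idealQuot A B) := Module.length_eq_one_iff.mp h
  have hx0 : (B.submoduleOf A).mkQ ⟨x, hx⟩ ≠ 0 := by
    rw [Submodule.mkQ_apply, Ne, Submodule.Quotient.mk_eq_zero]
    exact hxB
  obtain ⟨c, hc⟩ := IsSimpleModule.toSpanSingleton_surjective R hx0
    ((B.submoduleOf A).mkQ ⟨y, hy⟩)
  refine ⟨c, ?_⟩
  rw [LinearMap.toSpanSingleton_apply, ← map_smul, eq_comm, ← sub_eq_zero, ← map_sub,
    Submodule.mkQ_apply, Submodule.Quotient.mk_eq_zero] at hc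
  exact hc

/-- An element of `V` is represented by an element of `I`, and represents zero exactly
when it lies in `J : I ^ n`. -/
theorem colonQuot_exists_rep (v : colonQuot I J n) :
    ∃ y, ∃ hy : y ∈ I, v = Submodule.Quotient.mk ⟨y, Ideal.mem_sup_left hy⟩ := by
  induction v using Submodule.Quotient.induction_on with
  | H z =>
    obtain ⟨z, hz⟩ := z
    obtain ⟨i, hi, c, hc, rfl⟩ := Submodule.mem_sup.mp hz
    refine ⟨i, hi, (Submodule.Quotient.eq _).mpr ?_⟩
    rw [Submodule.submoduleOf, Submodule.mem_comap]
    simpa using hc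

/-- Otherwise the class of `x` would span `V`, whose rank would be at most one. -/
theorem exists_linearIndependent_rep [IsLocalRing R]
    (hlen : Module.length R (idealQuot (I ^ (n + 1)) (J * I ^ n)) = 1)
    (hb : 2 ≤ colonQuotDim I J n hlen) {x : R} (hx : x ∈ I) :
    ∃ y ∈ I, ∀ c : R, y - c * x ∉ J.colon (↑(I ^ n) : Set R) := by
  let : Module (ResidueField R) (colonQuot I J n) :=
    (colonQuot_isTorsionBySet I J n hlen).module
  by_contra! H
  let v : colonQuot I J n := Submodule.Quotient.mk ⟨x, Ideal.mem_sup_left hx⟩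
  have hspan : Submodule.span (ResidueField R) {v} = ⊤ := by
    rw [eq_top_iff]
    rintro w -
    obtain ⟨y, hy, rfl⟩ := colonQuot_exists_rep w
    obtain ⟨c, hc⟩ := H y hy
    refine Submodule.mem_span_singleton.mpr ⟨residue R c, ?_⟩
    change c • v = _
    refine ((Submodule.Quotient.eq _).mpr ?_).symm
    rw [Submodule.submoduleOf, Submodule.mem_comap]
    simpa using hc
  have h1 : Module.rank (ResidueField R) (colonQuot I J n) ≤ 1 :=
    rank_le_one_iff.mpr ⟨v, fun w => Submodule.mem_span_singleton.mp (hspan ▸ Submodule.mem_top)⟩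
  exact absurd (hb.trans h1) (by simp)

theorem mem_colon_pow {z : R} :
    z ∈ J.colon (↑(I ^ n) : Set R) ↔ ∀ u ∈ I ^ n, z * u ∈ J := by
  rw [Submodule.mem_colon]
  rfl

theorem mul_mem_pow_succ {z u : R} (hz : z ∈ I) (hu : u ∈ I ^ n) : z * u ∈ I ^ (n + 1) := by
  rw [pow_succ']
  exact Ideal.mul_mem_mul hz hu

theorem inf_pow_succ_le_of_length_eq_one [IsLocalRing R]
    (hlen : Module.length R (idealQuot (I ^ (n + 1)) (J * I ^ n)) = 1)
    (hb : 2 ≤ colonQuotDim I J n hlen) : J ⊓ I ^ (n + 1) ≤ J * I ^ n := by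
  rintro z ⟨hzJ, hzI⟩
  by_contra hz
  -- Taking `x = 0` only asks for `y` outside `J : I ^ n`, that is, for `V ≠ 0`.
  obtain ⟨y, hy, H⟩ := exists_linearIndependent_rep hlen hb (zero_mem I)
  refine H 0 (mem_colon_pow.mpr fun u hu => ?_)
  have hyu : y * u ∈ I ^ (n + 1) := mul_mem_pow_succ hy hu
  obtain ⟨c, hc⟩ := exists_smul_sub_mem_of_length_eq_one hlen hzI hz hyu
  have hc' : y * u - c * z ∈ J := Ideal.mul_le_left hc
  have := J.add_mem hc' (J.mul_mem_left c hzJ)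
  rw [zero_mul, sub_zero]
  rwa [sub_add_cancel] at this

/-- Two elements of `I` independent in `V` are separated by multiplication
`I ^ n → I ^ (n + 1) / J I ^ n`. -/
theorem exists_separating
    (hlen : Module.length R (idealQuot (I ^ (n + 1)) (J * I ^ n)) = 1)
    {x y : R} (hx : x ∈ I) (hy : y ∈ I)
    (hxy : ∀ c : R, y - c * x ∉ J.colon (↑(I ^ n) : Set R)) :
    ∃ u ∈ I ^ n, x * u ∈ J * I ^ n ∧ y * u ∉ J * I ^ n := by
  by_contra! H
  -- If `x` pairs nontrivially with `u₀`, each `u` is a multiple of `u₀` plus an element killed by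
  -- `x`, hence also by `y`; then `y - c x` kills everything, with `c` read off at `u₀`. If `x`
  -- pairs to zero, so does `y`.
  by_cases h0 : ∃ u₀ ∈ I ^ n, x * u₀ ∉ J * I ^ n
  · obtain ⟨u₀, hu₀, hxu₀⟩ := h0
    obtain ⟨c, hc⟩ := exists_smul_sub_mem_of_length_eq_one hlen (mul_mem_pow_succ hx hu₀) hxu₀ (mul_mem_pow_succ hy hu₀)
    refine hxy c (mem_colon_pow.mpr fun u hu => ?_)
    obtain ⟨a, ha⟩ := exists_smul_sub_mem_of_length_eq_one hlen (mul_mem_pow_succ hx hu₀) hxu₀ (mul_mem_pow_succ hx hu)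
    have h1 : y * (u - a * u₀) ∈ J * I ^ n :=
      H _ (sub_mem hu (Ideal.mul_mem_left _ _ hu₀)) (by convert ha using 1; ring)
    have h2 : (y - c * x) * u ∈ J * I ^ n := by
      have := add_mem (sub_mem h1 (Ideal.mul_mem_left _ c ha)) (Ideal.mul_mem_left _ a hc)
      convert this using 1
      ring
    exact Ideal.mul_le_left h2
  · push Not at h0
    refine hxy 0 (mem_colon_pow.mpr fun u hu => ?_)
    rw [zero_mul, sub_zero]
    exact Ideal.mul_le_left (H u hu (h0 u hu))

theorem pow_add_two_eq_of_length_eq_one [IsLocalRing R] (hJI : J ≤ I)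
    (hlen : Module.length R (idealQuot (I ^ (n + 1)) (J * I ^ n)) = 1)
    (hb : 2 ≤ colonQuotDim I J n hlen) : I ^ (n + 2) = J * I ^ (n + 1) := by
  rw [pow_succ' I (n + 1)]
  refine le_antisymm ?_ (Ideal.mul_mono_left hJI)
  rw [Ideal.mul_le]
  intro x hx w hw
  obtain ⟨y, hy, hxy⟩ := exists_linearIndependent_rep hlen hb hx
  obtain ⟨u, hu, hxu, hyu⟩ := exists_separating hlen hx hy hxy
  have hyu' : y * u ∈ I ^ (n + 1) := mul_mem_pow_succ hy hu
  obtain ⟨c, hc⟩ := exists_smul_sub_mem_of_length_eq_one hlen hyu' hyu hw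
  have key : ∀ {z v : R}, z ∈ I → v ∈ J * I ^ n → z * v ∈ J * I ^ (n + 1) := by
    intro z v hz hv
    rw [pow_succ', mul_left_comm]
    exact Ideal.mul_mem_mul hz hv
  -- The identity is `x w = x (w - c y u) + c y (x u)`.
  have := add_mem (key hx hc) (Ideal.mul_mem_left _ c (key hy hxu))
  convert this using 1
  ring

theorem pow_succ_eq_of_le (hred : I ^ (n + 2) = J * I ^ (n + 1)) {k : ℕ} (hk : n + 1 ≤ k) :
    I ^ (k + 1) = J * I ^ k := by
  obtain ⟨m, rfl⟩ := Nat.exists_eq_add_of_le hk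
  rw [show n + 1 + m + 1 = n + 2 + m by ring, pow_add, hred, mul_assoc, ← pow_add]

/-- The Valabrega–Valla condition in all degrees. -/
theorem inf_pow_succ_le [IsLocalRing R] (hJI : J ≤ I)
    (hlen : Module.length R (idealQuot (I ^ (n + 1)) (J * I ^ n)) = 1)
    (ha : ∀ k : ℕ, 1 ≤ k → k ≤ n → J ⊓ I ^ k = J * I ^ (k - 1))
    (hb : 2 ≤ colonQuotDim I J n hlen) (k : ℕ) : J ⊓ I ^ (k + 1) ≤ J * I ^ k := by
  rcases lt_trichotomy k n with hk | rfl | hk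
  · exact (ha (k + 1) (by omega) (by omega)).le
  · exact inf_pow_succ_le_of_length_eq_one hlen hb
  · exact inf_le_right.trans
      (pow_succ_eq_of_le (pow_add_two_eq_of_length_eq_one hJI hlen hb) hk).le

end Pairing

/-! ### Congruences between values of forms. -/

section FormCongruence

variable {R : Type u} [CommRing R] {ι : Type*} [Fintype ι]

theorem prod_pow_mem_pow_degree {J : Ideal R} {u : ι → R} (hu : ∀ i, u i ∈ J) (a : ι →₀ ℕ) :
    ∏ i, u i ^ a i ∈ J ^ a.degree := by
  rw [Finsupp.degree_eq_sum, ← Finset.prod_pow_eq_pow_sum]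
  exact Ideal.prod_mem_prod fun i _ => Ideal.pow_mem_pow (hu i) _

/-- One variable is split off at a time, by `p q - r s = (p - r) q + r (q - s)`. -/
theorem prod_pow_sub_prod_pow_mem {J K : Ideal R} {u v : ι → R} (hu : ∀ i, u i ∈ J)
    (hv : ∀ i, v i ∈ J) (huv : ∀ i, u i - v i ∈ K) (k : ℕ) (a : ι →₀ ℕ) (ha : a.degree = k + 1) :
    ∏ i, u i ^ a i - ∏ i, v i ^ a i ∈ K * J ^ k := by
  classical
  induction k generalizing a with
  | zero | succ k ih =>
    have ha0 : a ≠ 0 := by rintro rfl; simp at ha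
    obtain ⟨i, hi⟩ := Finsupp.ne_iff.mp ha0
    obtain ⟨a', rfl⟩ : ∃ a', a = Finsupp.single i 1 + a' :=
      ⟨a - Finsupp.single i 1, (add_tsub_cancel_of_le (by
        rw [Finsupp.single_le_iff]; exact Nat.one_le_iff_ne_zero.mpr hi)).symm⟩
    rw [map_add, Finsupp.degree_single, add_comm, Nat.add_right_cancel_iff] at ha
    have key : ∀ w : ι → R, ∏ j, w j ^ (Finsupp.single i 1 + a' : ι →₀ ℕ) j =
        w i * ∏ j, w j ^ a' j := fun w => by
      simp_rw [Finsupp.add_apply, pow_add, Finset.prod_mul_distrib]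
      congr 1
      rw [Finset.prod_eq_single i] <;> simp +contextual [eq_comm]
    rw [key, key]
    -- The first alternative closes `k = 0`, where a single variable remains; the second is the
    -- inductive step.
    first
    | obtain rfl := (Finsupp.degree_eq_zero_iff a').mp ha
      simpa using huv i
    | rw [show ∀ p q r s : R, p * q - r * s = (p - r) * q + r * (q - s) by intros; ring]
      refine add_mem (Ideal.mul_mem_mul (huv i) ?_) ?_
      · rw [← ha]
        exact prod_pow_mem_pow_degree hu a'
      · rw [pow_succ', mul_left_comm]
        exact Ideal.mul_mem_mul (hv i) (ih a' ha)

theorem eval_sub_eval_mem {J K : Ideal R} {u v : ι → R} (hu : ∀ i, u i ∈ J)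
    (hv : ∀ i, v i ∈ J) (huv : ∀ i, u i - v i ∈ K) {k : ℕ} {P : MvPolynomial ι R}
    (hP : P.IsHomogeneous (k + 1)) :
    MvPolynomial.eval u P - MvPolynomial.eval v P ∈ K * J ^ k := by
  rw [MvPolynomial.eval_eq', MvPolynomial.eval_eq', ← Finset.sum_sub_distrib]
  refine Ideal.sum_mem _ fun a ha => ?_
  rw [← mul_sub]
  refine Ideal.mul_mem_left _ _ (prod_pow_sub_prod_pow_mem hu hv huv k a ?_)
  have h : Finsupp.weight (fun _ => 1) a = k + 1 := hP (MvPolynomial.mem_support_iff.mp ha)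
  rwa [← Finsupp.degree_eq_weight_one] at h

theorem eval_mul_of_isHomogeneous {s : ℕ} {P : MvPolynomial ι R}
    (hP : P.IsHomogeneous s) (c : R) (v : ι → R) :
    MvPolynomial.eval (fun i => c * v i) P = c ^ s * MvPolynomial.eval v P := by
  rw [MvPolynomial.eval_eq', MvPolynomial.eval_eq', Finset.mul_sum]
  refine Finset.sum_congr rfl fun a ha => ?_
  have h : Finsupp.weight (fun _ => 1) a = s := hP (MvPolynomial.mem_support_iff.mp ha)
  rw [← Finsupp.degree_eq_weight_one] at h
  simp_rw [mul_pow, Finset.prod_mul_distrib]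
  rw [Finset.prod_pow_eq_pow_sum, ← Finsupp.degree_eq_sum, h]
  ring

theorem pow_succ_le_sup_span_pow {J K : Ideal R} {b : R} (hb : b ∈ J)
    (hJ : J ≤ K ⊔ Ideal.span {b}) (k : ℕ) :
    J ^ (k + 1) ≤ K * J ^ k ⊔ Ideal.span {b ^ (k + 1)} := by
  induction k with
  | zero => simpa using hJ
  | succ k ih =>
    rw [pow_succ' J (k + 1)]
    refine (Ideal.mul_mono_right ih).trans ?_
    rw [Ideal.mul_sup, sup_le_iff]
    constructor
    · rw [mul_left_comm, ← pow_succ']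
      exact le_sup_left
    · refine (Ideal.mul_mono_left hJ).trans ?_
      rw [Ideal.sup_mul, Ideal.span_singleton_mul_span_singleton, ← pow_succ']
      refine sup_le_sup_right (Ideal.mul_mono_right ?_) _
      rw [Ideal.span_singleton_le_iff_mem]
      exact Ideal.pow_mem_pow hb _

end FormCongruence

/-! ### Independence of the monomials in the generators of a minimal reduction. -/

section Independence

theorem IsReduction.trans_of_pow_eq {R : Type u} [CommRing R] {I J K : Ideal R} (hJ : IsReduction I J) (hK : K ≤ J) {k : ℕ}
    (hk : J ^ (k + 1) = K * J ^ k) : IsReduction I K := by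
  obtain ⟨hJI, r, hr⟩ := hJ
  have hpow : ∀ m, I ^ (m + r) = J ^ m * I ^ r := by
    intro m
    induction m with
    | zero => simp
    | succ m ih => rw [show m + 1 + r = m + r + 1 by ring, pow_succ', ih, mul_left_comm, ← pow_succ',
        hr, pow_succ, mul_assoc]
  refine ⟨hK.trans hJI, k + r, ?_⟩
  rw [show k + r + 1 = k + 1 + r by ring, hpow, hk, hpow, mul_assoc]

variable {R : Type u} [CommRing R] [IsLocalRing R] {ι : Type*} [Fintype ι]

/-- A form with a unit coefficient has, after a linear change of coordinates, a unit value at a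
point with one coordinate equal to one. -/
theorem exists_normalized_eval_isUnit [Infinite (ResidueField R)] {k : ℕ} {P : MvPolynomial ι R}
    (hP : P.IsHomogeneous (k + 1)) {a : ι →₀ ℕ} (ha : P.coeff a ∉ maximalIdeal R) :
    ∃ (i₀ : ι) (c : ι → R), c i₀ = 1 ∧ IsUnit (MvPolynomial.eval c P) := by
  classical
  have hne : MvPolynomial.map (residue R) P ≠ 0 := fun h => ha <| by
    have := congrArg (MvPolynomial.coeff a) h
    rwa [MvPolynomial.coeff_map, MvPolynomial.coeff_zero, residue_eq_zero_iff] at this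
  obtain ⟨c', hc'⟩ : ∃ c', MvPolynomial.eval c' (MvPolynomial.map (residue R) P) ≠ 0 := by
    by_contra! h
    exact hne (MvPolynomial.funext fun x => by rw [h x, map_zero])
  choose c hc using fun i => residue_surjective (c' i)
  have hu : IsUnit (MvPolynomial.eval c P) := by
    rw [← residue_ne_zero_iff_isUnit]
    convert hc' using 1
    rw [MvPolynomial.eval_map, ← funext hc, MvPolynomial.eval_eq', MvPolynomial.eval₂_eq']
    simp
  -- A form of positive degree takes values in the maximal ideal at points with all coordinates
  -- there.
  obtain ⟨i₀, hi₀⟩ : ∃ i, IsUnit (c i) := by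
    by_contra! h
    have h' : ∀ i, c i ∈ maximalIdeal R := h
    have := eval_sub_eval_mem (J := maximalIdeal R) (K := maximalIdeal R) (v := fun _ => 0) h'
      (fun _ => zero_mem _) (fun i => by simpa using h' i) hP
    have h0 := eval_mul_of_isHomogeneous hP (0 : R) c
    simp only [zero_mul, zero_pow (Nat.succ_ne_zero k)] at h0
    rw [h0, sub_zero] at this
    exact (Ideal.mul_le_left this : _ ∈ maximalIdeal R) hu
  obtain ⟨w, hw⟩ := hi₀
  refine ⟨i₀, fun i => (↑w⁻¹ : R) * c i, by simp [← hw], ?_⟩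
  rw [eval_mul_of_isHomogeneous hP]
  exact ((Units.isUnit _).pow _).mul hu

/-- If the monomials in the generators `b` of `J` of some degree are dependent modulo the maximal
ideal, then `J` has a reduction with fewer generators. -/
theorem exists_reduction_of_eval_mem [IsNoetherianRing R] [Infinite (ResidueField R)]
    {J : Ideal R} {b : ι → R} (hb : J = Ideal.span (Set.range b))
    {s : ℕ} {P : MvPolynomial ι R} (hP : P.IsHomogeneous s)
    (hPb : MvPolynomial.eval b P ∈ maximalIdeal R * J ^ s) {a : ι →₀ ℕ}
    (ha : P.coeff a ∉ maximalIdeal R) :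
    ∃ K ≤ J, K.spanFinrank < Fintype.card ι ∧ ∃ k, J ^ (k + 1) = K * J ^ k := by
  classical
  have hbJ : ∀ i, b i ∈ J := fun i => hb ▸ Ideal.subset_span ⟨i, rfl⟩
  cases s with
  | zero =>
    have hC := MvPolynomial.totalDegree_eq_zero_iff_eq_C.mp
      ((MvPolynomial.totalDegree_zero_iff_isHomogeneous _).mpr hP)
    rw [hC, MvPolynomial.eval_C, pow_zero, mul_one] at hPb
    rw [hC, MvPolynomial.coeff_C] at ha
    split_ifs at ha
    · exact absurd hPb ha
    · exact absurd (zero_mem _) ha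
  | succ k =>
    obtain ⟨i₀, c, hc₀, hc⟩ := exists_normalized_eval_isUnit hP ha
    -- Modulo `K` each `b i` is `c i * b i₀`, so `P(b)` is `b i₀ ^ (k + 1)` times the unit `P(c)`,
    -- modulo `K J ^ k`. Hence `b i₀ ^ (k + 1) ∈ K J ^ k + 𝔪 J ^ (k + 1)`, and Nakayama gives `J ^
    -- (k + 1) = K J ^ k`.
    let K : Ideal R := Ideal.span ((fun i => b i - c i * b i₀) '' (Finset.univ.erase i₀ : Finset ι))
    have hK : ∀ i, b i - b i₀ * c i ∈ K := fun i => by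
      rw [mul_comm]
      by_cases hi : i = i₀
      · rw [hi, hc₀, one_mul, sub_self]
        exact zero_mem _
      · exact Ideal.subset_span ⟨i, by simpa using hi, rfl⟩
    have hKJ : K ≤ J := by
      rw [Ideal.span_le]
      rintro _ ⟨i, -, rfl⟩
      exact sub_mem (hbJ i) (Ideal.mul_mem_left _ _ (hbJ i₀))
    refine ⟨K, hKJ, ?_, k, ?_⟩
    · refine (Submodule.spanFinrank_span_le_ncard_of_finite (Set.toFinite _)).trans_lt ?_
      refine (Set.ncard_image_le (Set.toFinite _)).trans_lt ?_
      rw [Set.ncard_coe_finset, Finset.card_erase_of_mem (Finset.mem_univ _), Finset.card_univ]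
      exact Nat.sub_lt (Fintype.card_pos_iff.mpr ⟨i₀⟩) one_pos
    · have hJK : J ≤ K ⊔ Ideal.span {b i₀} := by
        conv_lhs => rw [hb]
        rw [Ideal.span_le]
        rintro _ ⟨i, rfl⟩
        have := add_mem (Ideal.mem_sup_left (hK i))
          (Ideal.mem_sup_right (Ideal.mul_mem_right (c i) _ (Ideal.mem_span_singleton_self (b i₀))))
        simpa using this
      have hpow : b i₀ ^ (k + 1) ∈ K * J ^ k ⊔ maximalIdeal R • J ^ (k + 1) := by
        have h1 := eval_sub_eval_mem hbJ (fun i => Ideal.mul_mem_right (c i) J (hbJ i₀)) hK hP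
        rw [eval_mul_of_isHomogeneous hP] at h1
        have h2 := sub_mem (Ideal.mem_sup_right hPb) (Ideal.mem_sup_left h1)
        rw [sub_sub_cancel] at h2
        exact (Ideal.mul_unit_mem_iff_mem _ hc).mp h2
      refine le_antisymm ?_ (pow_succ' J k ▸ Ideal.mul_mono_left hKJ)
      refine Submodule.le_of_le_smul_of_le_jacobson_bot (I := maximalIdeal R)
        (IsNoetherian.noetherian _) (maximalIdeal_le_jacobson _) ?_
      refine (pow_succ_le_sup_span_pow (hbJ i₀) hJK k).trans (sup_le le_sup_left ?_)
      rwa [Ideal.span_singleton_le_iff_mem]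

/-- The monomials in a minimal system of generators of a minimal reduction are independent modulo
the maximal ideal. -/
theorem coeff_mem_of_isMinimalReduction [IsNoetherianRing R] [Infinite (ResidueField R)]
    {I J : Ideal R} (hJ : IsMinimalReduction I J)
    {b : ι → R} (hb : J = Ideal.span (Set.range b)) (hι : Fintype.card ι = J.spanFinrank)
    {s : ℕ} {P : MvPolynomial ι R} (hP : P.IsHomogeneous s)
    (hPb : MvPolynomial.eval b P ∈ maximalIdeal R * J ^ s) (a : ι →₀ ℕ) :
    P.coeff a ∈ maximalIdeal R := by
  by_contra ha
  obtain ⟨K, hKJ, hK, k, hk⟩ := exists_reduction_of_eval_mem hb hP hPb ha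
  have := hJ.2 (hJ.1.trans_of_pow_eq hKJ hk) hKJ
  rw [le_antisymm hKJ this, hι] at hK
  exact lt_irrefl _ hK

end Independence

/-! ### Lower bound for `λ(R / J ^ s)` by counting monomials. -/

section LengthLowerBound

variable {R : Type u} [CommRing R]

theorem length_quotient_anti {A B : Ideal R} (h : A ≤ B) :
    Module.length R (R ⧸ B) ≤ Module.length R (R ⧸ A) :=
  Module.length_le_of_surjective (Submodule.factor h) (Submodule.factor_surjective h)

theorem card_le_length_quotient_ker [IsLocalRing R] {σ : Type*} [Fintype σ] (N : Submodule R (σ → R))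
    (hN : ∀ c ∈ N, ∀ i, c i ∈ maximalIdeal R) :
    (Fintype.card σ : ℕ∞) ≤ Module.length R ((σ → R) ⧸ N) := by
  let π : (σ → R) →ₗ[R] (σ → R ⧸ maximalIdeal R) :=
    LinearMap.pi fun i => (maximalIdeal R).mkQ ∘ₗ LinearMap.proj i
  have hπ : Function.Surjective π := fun w => by
    choose c hc using fun i => Submodule.mkQ_surjective _ (w i)
    exact ⟨c, funext hc⟩
  have hker : N ≤ LinearMap.ker π := fun c hc => by
    rw [LinearMap.mem_ker]
    funext i
    exact (Submodule.Quotient.mk_eq_zero _).mpr (hN c hc i)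
  have hsimple : IsSimpleModule R (R ⧸ maximalIdeal R) :=
    isSimpleModule_iff_quot_maximal.mpr ⟨_, inferInstance, ⟨LinearEquiv.refl _ _⟩⟩
  have h1 := Module.length_le_of_surjective (N.liftQ π hker) fun w => by
    obtain ⟨c, hc⟩ := hπ w
    exact ⟨N.mkQ c, by rw [Submodule.mkQ_apply, Submodule.liftQ_apply, hc]⟩
  rw [Module.length_pi, Module.length_eq_one] at h1
  simpa using h1

/-- A family of elements of `A` which is independent modulo `N` in the sense that all its relations
have coefficients in the maximal ideal contributes its cardinality to the length of `A / N`. -/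
theorem length_quotient_add_card_le [IsLocalRing R] {σ : Type*} [Fintype σ] {A N : Ideal R}
    (hNA : N ≤ A) {x : σ → R} (hx : ∀ i, x i ∈ A)
    (hind : ∀ c : σ → R, ∑ i, c i * x i ∈ N → ∀ i, c i ∈ maximalIdeal R) :
    Module.length R (R ⧸ A) + Fintype.card σ ≤ Module.length R (R ⧸ N) := by
  let φ : (σ → R) →ₗ[R] R ⧸ N := N.mkQ ∘ₗ Fintype.linearCombination R x
  have hφ : ∀ c, φ c = Submodule.Quotient.mk (∑ i, c i * x i) := fun c => by
    simp [φ, Fintype.linearCombination_apply]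
  have h1 := Module.length_eq_add_of_exact (LinearMap.range φ).subtype (LinearMap.range φ).mkQ
    (Submodule.subtype_injective _) (Submodule.mkQ_surjective _) (LinearMap.exact_subtype_mkQ _)
  have h2 : (Fintype.card σ : ℕ∞) ≤ Module.length R (LinearMap.range φ) := by
    rw [← (LinearMap.quotKerEquivRange φ).length_eq]
    refine card_le_length_quotient_ker _ fun c hc => hind c ?_
    rw [LinearMap.mem_ker, hφ] at hc
    exact (Submodule.Quotient.mk_eq_zero _).mp hc
  have hle : LinearMap.range φ ≤ LinearMap.ker (Submodule.factor hNA) := by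
    rintro _ ⟨c, rfl⟩
    rw [LinearMap.mem_ker, hφ]
    exact (Submodule.Quotient.mk_eq_zero _).mpr
      (Ideal.sum_mem _ fun i _ => Ideal.mul_mem_left _ _ (hx i))
  have h3 : Module.length R (R ⧸ A) ≤ Module.length R ((R ⧸ N) ⧸ LinearMap.range φ) :=
    Module.length_le_of_surjective ((LinearMap.range φ).liftQ (Submodule.factor hNA) hle) fun w => by
      obtain ⟨c, hc⟩ := Submodule.factor_surjective hNA w
      exact ⟨(LinearMap.range φ).mkQ c, by rw [Submodule.mkQ_apply, Submodule.liftQ_apply, hc]⟩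
  rw [h1, add_comm]
  exact add_le_add h2 h3

/-- If the monomials of each degree in `b` are independent modulo the maximal ideal, then the
length of `R / J ^ s` is at least the number of monomials of degree less than `s`. -/
theorem card_monomials_le_length [IsLocalRing R] {ι : Type*} [Fintype ι] {J : Ideal R} {b : ι → R}
    (hJ : J ≤ maximalIdeal R) (hb : ∀ i, b i ∈ J)
    (hind : ∀ (s : ℕ) (P : MvPolynomial ι R), P.IsHomogeneous s →
      MvPolynomial.eval b P ∈ maximalIdeal R * J ^ s → ∀ a, P.coeff a ∈ maximalIdeal R)
    (T : Finset (ι →₀ ℕ)) (s : ℕ) :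
    ((T.filter fun a => a.degree < s).card : ℕ∞) ≤ Module.length R (R ⧸ J ^ s) := by
  classical
  induction s with
  | zero => simp
  | succ s ih =>
    let U := T.filter fun a => a.degree = s
    have hsplit : (T.filter fun a => a.degree < s + 1).card =
        (T.filter fun a => a.degree < s).card + Fintype.card U := by
      rw [Fintype.card_coe, ← Finset.card_union_of_disjoint, ← Finset.filter_or]
      · simp_rw [Nat.lt_succ_iff_lt_or_eq]
      · exact Finset.disjoint_filter.mpr fun a _ h h' => h.ne h'
    rw [hsplit, Nat.cast_add]
    refine (add_le_add_left ih _).trans ?_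
    have hU : ∀ a : U, (a : ι →₀ ℕ).degree = s := fun a => (Finset.mem_filter.mp a.2).2
    -- The monomials of degree `s` are independent in `J ^ s / 𝔪 J ^ s`, which is a quotient of `J ^
    -- s / J ^ (s + 1)` because `J ⊆ 𝔪`.
    refine (length_quotient_add_card_le (N := maximalIdeal R * J ^ s) Ideal.mul_le_right
      (x := fun a : U => ∏ i, b i ^ (a : ι →₀ ℕ) i) (fun a => ?_) fun c hc a => ?_).trans ?_
    · rw [← hU a]
      exact prod_pow_mem_pow_degree hb _
    · let P : MvPolynomial ι R := ∑ a : U, MvPolynomial.monomial (a : ι →₀ ℕ) (c a)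
      have hP : P.IsHomogeneous s := MvPolynomial.IsHomogeneous.sum _ _ _ fun a _ =>
        MvPolynomial.isHomogeneous_monomial _ (hU a)
      have hPe : MvPolynomial.eval b P = ∑ a : U, c a * ∏ i, b i ^ (a : ι →₀ ℕ) i := by
        rw [map_sum]
        refine Finset.sum_congr rfl fun a _ => ?_
        rw [MvPolynomial.eval_monomial, Finsupp.prod_fintype _ _ fun i => pow_zero _]
      have := hind s P hP (hPe ▸ hc) a
      rwa [MvPolynomial.coeff_sum, Finset.sum_eq_single a, MvPolynomial.coeff_monomial,
        if_pos rfl] at this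
      · intro a' _ hne
        rw [MvPolynomial.coeff_monomial, if_neg fun h => hne (Subtype.ext h)]
      · simp
    · rw [pow_succ']
      exact length_quotient_anti (Ideal.mul_mono_left hJ)

/-- Box count: `t ^ ℓ ≤ λ(R / J ^ (ℓ t))`. -/
theorem pow_card_le_length [IsLocalRing R] {ι : Type*} [Fintype ι] [Nonempty ι] {J : Ideal R}
    {b : ι → R} (hJ : J ≤ maximalIdeal R) (hb : ∀ i, b i ∈ J)
    (hind : ∀ (s : ℕ) (P : MvPolynomial ι R), P.IsHomogeneous s →
      MvPolynomial.eval b P ∈ maximalIdeal R * J ^ s → ∀ a, P.coeff a ∈ maximalIdeal R) (t : ℕ) :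
    ((t ^ Fintype.card ι : ℕ) : ℕ∞) ≤ Module.length R (R ⧸ J ^ (Fintype.card ι * t)) := by
  classical
  -- The monomials with all exponents below `t` number `t ^ ℓ` and have degree below `ℓ t`.
  let e : (ι → Fin t) → (ι →₀ ℕ) := fun a => Finsupp.equivFunOnFinite.symm fun i => (a i : ℕ)
  have he : Function.Injective e := fun a a' h => by
    funext i
    exact Fin.ext (DFunLike.congr_fun h i)
  refine le_trans ?_ (card_monomials_le_length hJ hb hind (Finset.univ.image e) _)
  rw [Finset.filter_true_of_mem, Finset.card_image_of_injective _ he, Finset.card_univ,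
    Fintype.card_fun, Fintype.card_fin]
  intro a ha
  obtain ⟨a, -, rfl⟩ := Finset.mem_image.mp ha
  rw [Finsupp.degree_eq_sum, ← smul_eq_mul, ← Finset.card_univ, ← Finset.sum_const]
  exact Finset.sum_lt_sum_of_nonempty Finset.univ_nonempty fun i _ => (a i).2

end LengthLowerBound

/-! ### Upper bound for lengths modulo powers of elements. -/

section LengthUpperBound

variable {R : Type u} [CommRing R]

/-- Multiplication by `x` maps `R / (Q + (y))` onto the kernel of `R / (Q + (x y)) → R / (Q + (x))`.
-/
theorem length_quotient_sup_mul_le (Q : Ideal R) (x y : R) :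
    Module.length R (R ⧸ Q ⊔ Ideal.span {x * y}) ≤
      Module.length R (R ⧸ Q ⊔ Ideal.span {x}) + Module.length R (R ⧸ Q ⊔ Ideal.span {y}) := by
  have hle : Q ⊔ Ideal.span {x * y} ≤ Q ⊔ Ideal.span {x} :=
    sup_le_sup_left (Ideal.span_singleton_le_span_singleton.mpr (dvd_mul_right x y)) _
  let g := Submodule.factor hle
  have h1 := Module.length_eq_add_of_exact (LinearMap.ker g).subtype g
    (Submodule.subtype_injective _) (Submodule.factor_surjective hle)
    (LinearMap.exact_subtype_ker_map g)
  let f : (R ⧸ Q ⊔ Ideal.span {y}) →ₗ[R] (R ⧸ Q ⊔ Ideal.span {x * y}) :=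
    Submodule.mapQ _ _ (LinearMap.lsmul R R x) <| by
      rw [sup_le_iff]
      constructor
      · intro q hq
        exact Ideal.mem_sup_left (Ideal.mul_mem_left _ _ hq)
      · rw [Ideal.span_singleton_le_iff_mem]
        exact Ideal.mem_sup_right (Ideal.mem_span_singleton_self _)
  have hker : LinearMap.ker g ≤ LinearMap.range f := by
    intro w hw
    obtain ⟨w, rfl⟩ := Submodule.mkQ_surjective _ w
    rw [LinearMap.mem_ker] at hw
    have hw' : w ∈ Q ⊔ Ideal.span {x} := (Submodule.Quotient.mk_eq_zero _).mp hw
    obtain ⟨q, hq, z, hz, rfl⟩ := Submodule.mem_sup.mp hw'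
    obtain ⟨r, rfl⟩ := Ideal.mem_span_singleton'.mp hz
    refine ⟨Submodule.Quotient.mk r, (Submodule.Quotient.eq _).mpr ?_⟩
    rw [LinearMap.lsmul_apply, smul_eq_mul, show x * r - (q + r * x) = -q by ring, neg_mem_iff]
    exact Ideal.mem_sup_left hq
  have h2 : Module.length R (LinearMap.ker g) ≤ Module.length R (R ⧸ Q ⊔ Ideal.span {y}) :=
    (Module.length_le_of_injective (Submodule.inclusion hker)
      (Submodule.inclusion_injective hker)).trans
      (Module.length_le_of_surjective f.rangeRestrict f.surjective_rangeRestrict)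
  rw [h1, add_comm]
  exact add_le_add_right h2 _

theorem length_quotient_sup_pow_le (Q : Ideal R) (x : R) (s : ℕ) :
    Module.length R (R ⧸ Q ⊔ Ideal.span {x ^ s}) ≤
      s * Module.length R (R ⧸ Q ⊔ Ideal.span {x}) := by
  induction s with
  | zero =>
    rw [pow_zero, Ideal.span_singleton_one, sup_top_eq, Nat.cast_zero, zero_mul, nonpos_iff_eq_zero,
      Module.length_eq_zero_iff]
    exact Ideal.Quotient.subsingleton_iff.mpr rfl
  | succ s ih =>
    rw [pow_succ, Nat.cast_succ, add_mul, one_mul]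
    exact (length_quotient_sup_mul_le Q _ _).trans (add_le_add_left ih _)

theorem length_quotient_sup_span_pow_le [DecidableEq R] (S : Finset R) (s : ℕ) (Q : Ideal R) :
    Module.length R (R ⧸ Q ⊔ Ideal.span ((fun x => x ^ s) '' (S : Set R))) ≤
      (s ^ S.card : ℕ) * Module.length R (R ⧸ Q ⊔ Ideal.span (S : Set R)) := by
  induction S using Finset.induction_on generalizing Q with
  | empty =>
    rw [Finset.coe_empty, Set.image_empty, Finset.card_empty, pow_zero, Nat.cast_one, one_mul]
  | insert x S hx ih =>
    rw [Finset.coe_insert, Set.image_insert_eq, Ideal.span_insert, Ideal.span_insert,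
      ← sup_assoc, Finset.card_insert_of_notMem hx]
    refine (ih _).trans ?_
    rw [sup_right_comm, pow_succ, Nat.cast_mul, mul_assoc]
    refine mul_le_mul_right ((length_quotient_sup_pow_le _ x s).trans ?_) _
    rw [sup_assoc, sup_comm (Ideal.span (S : Set R))]

end LengthUpperBound

/-! ### The number of generators of a minimal reduction. -/

section SpanFinrank

variable {R : Type u} [CommRing R] [IsLocalRing R] [IsNoetherianRing R]

theorem length_quotient_span_ne_top {S : Finset R}
    (hS : maximalIdeal R ∈ (Ideal.span (S : Set R)).minimalPrimes) :
    Module.length R (R ⧸ Ideal.span (S : Set R)) ≠ ⊤ := by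
  have h1 := IsLocalRing.quotient_artinian_of_mem_minimalPrimes_of_isLocalRing _ hS
  rw [Module.length_eq_of_surjective (S := R) (R := R ⧸ Ideal.span (S : Set R))
    Ideal.Quotient.mk_surjective]
  exact Module.length_ne_top

/-- The length of `R / J ^ s` grows at most like `s ^ dim R`. -/
theorem exists_length_quotient_pow_le {d : ℕ} (hdim : ringKrullDim R = d) {J : Ideal R}
    {N : ℕ} (hN : maximalIdeal R ^ N ≤ J) :
    ∃ L : ℕ, ∀ s : ℕ, Module.length R (R ⧸ J ^ s) ≤ (((N * s) ^ d * L : ℕ) : ℕ∞) := by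
  classical
  -- `S` is a system of parameters. For `x ∈ S` one has `x ^ N ∈ J`, so the powers `x ^ (N s)` lie
  -- in `J ^ s` and it suffices to bound the length modulo these powers.
  obtain ⟨S, hS, hcard⟩ := (maximalIdeal R).exists_finset_card_eq_height_of_isNoetherianRing
  have hd : S.card = d := by
    have := IsLocalRing.maximalIdeal_height_eq_ringKrullDim (R := R)
    rw [hdim, ← hcard] at this
    exact_mod_cast this
  obtain ⟨L, hL⟩ := ENat.ne_top_iff_exists.mp (length_quotient_span_ne_top hS)
  refine ⟨L, fun s => ?_⟩
  have h := length_quotient_sup_span_pow_le S (N * s) ⊥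
  rw [bot_sup_eq, bot_sup_eq, ← hL, hd, ← Nat.cast_mul] at h
  refine (length_quotient_anti ?_).trans h
  rw [Ideal.span_le]
  rintro _ ⟨x, hx, rfl⟩
  change x ^ (N * s) ∈ J ^ s
  rw [pow_mul]
  exact Ideal.pow_mem_pow (hN (Ideal.pow_mem_pow (hS.1.2 (Ideal.subset_span hx)) _)) _

/-- A minimal reduction of an ideal primary to the maximal ideal is generated by at most
`dim R` elements. -/
theorem spanFinrank_le_of_isMinimalReduction [Infinite (ResidueField R)] {d : ℕ}
    (hdim : ringKrullDim R = d) {I J : Ideal R} (hJ : IsMinimalReduction I J)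
    (hJm : J ≤ maximalIdeal R) {N : ℕ} (hN : maximalIdeal R ^ N ≤ J) : J.spanFinrank ≤ d := by
  obtain ⟨S, hScard, hS⟩ := Submodule.FG.exists_span_finset_card_eq_spanFinrank
    (IsNoetherian.noetherian J)
  by_contra! hlt
  have hcard : Fintype.card S = J.spanFinrank := by rw [Fintype.card_coe, hScard]
  have hne : Nonempty S := Fintype.card_pos_iff.mp (by omega)
  have hb : J = Ideal.span (Set.range ((↑) : S → R)) := by
    rw [Subtype.range_coe_subtype]
    exact hS.symm
  obtain ⟨L, hL⟩ := exists_length_quotient_pow_le hdim hN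
  have key : ∀ t : ℕ, t ^ Fintype.card S ≤ (N * (Fintype.card S * t)) ^ d * L := fun t => by
    have := (pow_card_le_length hJm (fun i => hb ▸ Ideal.subset_span ⟨i, rfl⟩)
      (fun s P hP hPb a => coeff_mem_of_isMinimalReduction hJ hb hcard hP hPb a) t).trans (hL _)
    exact_mod_cast this
  -- The two bounds give `t ^ |S| ≤ C t ^ d` for all `t`. If `|S| > d`, this fails at `t = C + 1`.
  set C := (N * Fintype.card S) ^ d * L with hC
  have h1 := key (C + 1)
  have h2 : (C + 1) ^ (d + 1) ≤ (C + 1) ^ Fintype.card S :=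
    Nat.pow_le_pow_right (Nat.succ_pos _) (by omega)
  have h3 : (C + 1) * (C + 1) ^ d ≤ C * (C + 1) ^ d := by
    calc (C + 1) * (C + 1) ^ d = (C + 1) ^ (d + 1) := (pow_succ' _ _).symm
      _ ≤ _ := h2.trans h1
      _ = C * (C + 1) ^ d := by rw [← mul_assoc, mul_pow, hC]; ring
  exact absurd (Nat.le_of_mul_le_mul_right h3 (by positivity)) (by omega)

end SpanFinrank

/-! ### Systems of parameters are regular sequences when the depth suffices. -/

section SystemOfParameters

open RingTheory.Sequence CategoryTheory Abelian Pointwise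

variable {R : Type u} [CommRing R] [IsLocalRing R] [IsNoetherianRing R]

/-- Let `U` be the nonzero submodule killed by `p`. If `U ⊆ y M`, regularity of `y` would give `U =
y U`, against Nakayama. So some `z ∈ U` has a nonzero class in `M / y M`, killed by `p` and by `y`;
its annihilator lies in an associated prime `q`. -/
theorem exists_mem_associatedPrimes_quotSMulTop {M : Type u} [AddCommGroup M] [Module R M]
    [Module.Finite R M] {y : R} (hy : y ∈ maximalIdeal R) (hreg : IsSMulRegular M y)
    {p : Ideal R} (hp : p ∈ associatedPrimes R M) :
    y ∉ p ∧ ∃ q ∈ associatedPrimes R (QuotSMulTop y M), p ≤ q ∧ y ∈ q := by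
  obtain ⟨hprime, x, hx⟩ := isAssociatedPrime_iff.mp hp
  have hmem : ∀ a, a ∈ p ↔ a • x = 0 := fun a => by
    rw [hx, Submodule.mem_colon_singleton, Submodule.mem_bot]
  have hx0 : x ≠ 0 := by
    rintro rfl
    exact hprime.ne_top ((Ideal.eq_top_iff_one _).mpr ((hmem 1).mpr (smul_zero _)))
  refine ⟨fun h => hx0 (hreg (by simpa using (hmem y).mp h)), ?_⟩
  let U : Submodule R M := Submodule.torsionBySet R M p
  have hUmem : ∀ z, z ∈ U ↔ ∀ a ∈ p, a • z = 0 := fun z => by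
    simp [U, Submodule.mem_torsionBySet_iff]
  have hxU : x ∈ U := (hUmem x).mpr fun a ha => (hmem a).mp ha
  obtain ⟨z, hzU, hz⟩ : ∃ z ∈ U, z ∉ y • (⊤ : Submodule R M) := by
    by_contra! H
    have hUbot : U = ⊥ := by
      refine Submodule.eq_bot_of_le_smul_of_le_jacobson_bot (Ideal.span {y}) U
        (IsNoetherian.noetherian U) (fun z hz => ?_) ?_
      · obtain ⟨z', -, rfl⟩ := (Submodule.mem_smul_pointwise_iff_exists _ _ _).mp (H z hz)
        refine Submodule.smul_mem_smul (Ideal.mem_span_singleton_self y) ((hUmem _).mpr fun a ha => ?_)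
        refine hreg ?_
        change y • a • z' = y • (0 : M)
        rw [smul_comm, (hUmem _).mp hz a ha, smul_zero]
      · rw [Ideal.span_singleton_le_iff_mem]
        exact maximalIdeal_le_jacobson _ hy
    exact hx0 ((Submodule.mem_bot R).mp (hUbot ▸ hxU))
  have hz0 : (y • (⊤ : Submodule R M)).mkQ z ≠ 0 := by
    rwa [Submodule.mkQ_apply, Ne, Submodule.Quotient.mk_eq_zero]
  obtain ⟨q, hq, hle⟩ := exists_le_isAssociatedPrime_of_isNoetherianRing R
    (M := QuotSMulTop y M) _ hz0
  have hann : ∀ a, a • z ∈ y • (⊤ : Submodule R M) → a ∈ q := fun a ha => by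
    refine hle ?_
    rw [Submodule.mem_colon_singleton, Submodule.mem_bot, ← map_smul, Submodule.mkQ_apply,
      Submodule.Quotient.mk_eq_zero]
    exact ha
  refine ⟨q, hq, fun a ha => hann a ?_, hann y (Submodule.smul_mem_pointwise_smul _ _ _ trivial)⟩
  rw [(hUmem z).mp hzU a ha]
  exact zero_mem _

/-- The length of a regular sequence is bounded by the dimension of every associated prime. -/
theorem length_le_ringKrullDim_quotient {M : Type u} [AddCommGroup M] [Module R M]
    [Module.Finite R M] {rs : List R} (hrs : IsWeaklyRegular M rs)
    (hmem : ∀ r ∈ rs, r ∈ maximalIdeal R) {p : Ideal R} (hp : p ∈ associatedPrimes R M) :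
    (rs.length : WithBot ℕ∞) ≤ ringKrullDim (R ⧸ p) := by
  induction rs generalizing M p with
  | nil =>
    have : p.IsPrime := hp.isPrime
    simpa using ringKrullDim_nonneg_of_nontrivial (R := R ⧸ p)
  | cons y rs ih =>
    rw [isWeaklyRegular_cons_iff] at hrs
    obtain ⟨hyp, q, hq, hpq, hyq⟩ :=
      exists_mem_associatedPrimes_quotSMulTop (hmem y List.mem_cons_self) hrs.1 hp
    have : p.IsPrime := hp.isPrime
    have h1 := ih hrs.2 (fun r hr => hmem r (List.mem_cons_of_mem _ hr)) hq
    have h2 : ringKrullDim (R ⧸ q) + 1 ≤ ringKrullDim (R ⧸ p) := by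
      refine ringKrullDim_succ_le_of_surjective (Ideal.Quotient.factor hpq)
        (Ideal.Quotient.factor_surjective hpq) (r := Ideal.Quotient.mk p y) ?_ ?_
      · rw [mem_nonZeroDivisors_iff_ne_zero]
        rwa [Ne, Ideal.Quotient.eq_zero_iff_mem]
      · rw [Ideal.Quotient.factor_mk, Ideal.Quotient.eq_zero_iff_mem]
        exact hyq
    rw [List.length_cons, Nat.cast_succ]
    exact (add_le_add_left h1 1).trans h2

/-- This is Krull's height theorem for the images of `bs` in `R / p`. -/
theorem ringKrullDim_quotient_le_length {p : Ideal R} [p.IsPrime] {bs : List R}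
    (h : maximalIdeal R ≤ (Ideal.ofList bs ⊔ p).radical) (hbs : ∀ b ∈ bs, b ∈ maximalIdeal R) :
    ringKrullDim (R ⧸ p) ≤ bs.length := by
  classical
  have : IsLocalRing (R ⧸ p) := .of_surjective' _ Ideal.Quotient.mk_surjective
  let S : Finset (R ⧸ p) := (bs.map (Ideal.Quotient.mk p)).toFinset
  have hS : ∀ x, x ∈ S ↔ ∃ b ∈ bs, Ideal.Quotient.mk p b = x := by simp [S]
  have hmin : maximalIdeal (R ⧸ p) ∈ (Ideal.span (S : Set (R ⧸ p))).minimalPrimes := by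
    refine ⟨⟨inferInstance, ?_⟩, fun q hq _ => ?_⟩
    · rw [Ideal.span_le]
      intro x hx
      obtain ⟨b, hb, rfl⟩ := (hS x).mp hx
      have : IsLocalHom (Ideal.Quotient.mk p) :=
        .of_surjective _ Ideal.Quotient.mk_surjective
      exact map_nonunit (Ideal.Quotient.mk p) b (hbs b hb)
    · intro x hx
      obtain ⟨a, rfl⟩ := Ideal.Quotient.mk_surjective x
      have hprime := hq.1
      have ha : a ∈ maximalIdeal R := fun hu => hx (hu.map _)
      suffices (Ideal.ofList bs ⊔ p).radical ≤ q.comap (Ideal.Quotient.mk p) from this (h ha)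
      rw [(hprime.comap _).radical_le_iff, sup_le_iff]
      constructor
      · refine Ideal.span_le.mpr fun b hb => hq.2 (Ideal.subset_span ?_)
        exact (hS _).mpr ⟨b, hb, rfl⟩
      · intro b hb
        rw [Ideal.mem_comap, Ideal.Quotient.eq_zero_iff_mem.mpr hb]
        exact zero_mem _
  have h1 := Ideal.height_le_card_of_mem_minimalPrimes_span_finset hmin
  rw [← IsLocalRing.maximalIdeal_height_eq_ringKrullDim]
  have h2 : S.card ≤ bs.length := (List.toFinset_card_le _).trans_eq (List.length_map _)
  exact_mod_cast h1.trans (by exact_mod_cast h2)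

/-- The quotient by a regular element has a regular sequence shorter by one. -/
theorem exists_isRegular_quotSMulTop {M : Type u} [AddCommGroup M] [Module R M]
    [Module.Finite R M] [Nontrivial M] {x : R} (hx : x ∈ maximalIdeal R) (hreg : IsSMulRegular M x)
    {n : ℕ} (h : ∃ rs : List R, rs.length = n + 1 ∧ (∀ r ∈ rs, r ∈ maximalIdeal R) ∧
      IsRegular M rs) :
    ∃ rs : List R, rs.length = n ∧ (∀ r ∈ rs, r ∈ maximalIdeal R) ∧
      IsRegular (QuotSMulTop x M) rs := by
  obtain ⟨rs, hlen, hmem, hrs⟩ := h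
  have hlt : ∀ (N : Type u) [AddCommGroup N] [Module R N] [Module.Finite R N] [Nontrivial N],
      maximalIdeal R • (⊤ : Submodule R N) < ⊤ := fun N _ _ _ _ =>
    (Submodule.top_ne_ideal_smul_of_le_jacobson_annihilator
      (maximalIdeal_le_jacobson _)).symm.lt_top
  have hsupp : Module.support R (R ⧸ maximalIdeal R) =
      PrimeSpectrum.zeroLocus (maximalIdeal R : Set R) := by
    rw [Module.support_eq_zeroLocus, Ideal.annihilator_quotient]
  -- Depth is read off from the vanishing of `Ext (R / 𝔪) M` in low degrees. In the long exact
  -- sequence of multiplication by `x`, `Ext ^ i` of `M / x M` sits between `Ext ^ i` and `Ext ^ (i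
  -- + 1)` of `M`.
  let M' : ModuleCat.{u} R := ModuleCat.of R M
  let k : ModuleCat.{u} R := ModuleCat.of R (R ⧸ maximalIdeal R)
  have h_ext := ModuleCat.subsingleton_ext_of_exists_isRegular (maximalIdeal R) k hsupp.le M'
    (hlt M) rs hmem hrs
  have : Nontrivial (QuotSMulTop x M) := nontrivial_quotSMulTop_of_mem_maximalIdeal _ hx
  refine ModuleCat.exists_isRegular_of_exists_subsingleton_ext (maximalIdeal R) n
    (ModuleCat.of R (QuotSMulTop x M)) (hlt _) k hsupp fun i hi => ?_
  have zero1 := AddCommGrpCat.isZero_of_iff_subsingleton.mpr (h_ext i (by omega))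
  have zero2 := AddCommGrpCat.isZero_of_iff_subsingleton.mpr (h_ext (i + 1) (by omega))
  have hreg' : IsSMulRegular M' x := hreg
  exact AddCommGrpCat.subsingleton_of_isZero <| ShortComplex.Exact.isZero_of_both_zeros
    ((Ext.covariant_sequence_exact₃' k hreg'.smulShortComplex_shortExact) i (i + 1) rfl)
    (zero1.eq_zero_of_src _) (zero2.eq_zero_of_tgt _)

/-- On a module of depth at least `n`, a sequence of `n` elements which generates an ideal primary
to the maximal ideal is regular. -/
theorem isWeaklyRegular_of_le_radical {M : Type u} [AddCommGroup M] [Module R M]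
    [Module.Finite R M] [Nontrivial M] {bs : List R} (hbs : ∀ b ∈ bs, b ∈ maximalIdeal R)
    {Q : Ideal R} (hQ : Q ≤ Module.annihilator R M)
    (hprim : maximalIdeal R ≤ (Ideal.ofList bs ⊔ Q).radical)
    (h : ∃ rs : List R, rs.length = bs.length ∧ (∀ r ∈ rs, r ∈ maximalIdeal R) ∧
      IsRegular M rs) :
    IsWeaklyRegular M bs := by
  induction bs generalizing M Q with
  | nil => exact .nil _ _
  | cons b bs ih =>
    have hb := hbs b List.mem_cons_self
    have hbs' : ∀ c ∈ bs, c ∈ maximalIdeal R := fun c hc => hbs c (List.mem_cons_of_mem _ hc)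
    -- If `b` lay in an associated prime `p`, then `bs` alone would be primary to `𝔪` modulo `p`, so
    -- `dim R / p ≤ |bs|`; but a regular sequence of length `|bs| + 1` forces `dim R / p ≥ |bs| +
    -- 1`.
    have hreg : IsSMulRegular M b := by
      by_contra hnot
      have : b ∈ ⋃ p ∈ associatedPrimes R M, (p : Set R) := by
        rw [biUnion_associatedPrimes_eq_compl_regular]
        exact hnot
      obtain ⟨p, hp, hbp⟩ := Set.mem_iUnion₂.mp this
      obtain ⟨rs, hlen, hmem, hrs⟩ := h
      have : p.IsPrime := hp.isPrime
      have h1 := length_le_ringKrullDim_quotient hrs.1 hmem hp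
      have hQp : Q ≤ p := hQ.trans (Submodule.annihilator_top (R := R) (M := M) ▸ hp.annihilator_le)
      have h2 : ringKrullDim (R ⧸ p) ≤ bs.length := by
        refine ringKrullDim_quotient_le_length (hprim.trans (Ideal.radical_mono ?_)) hbs'
        rw [Ideal.ofList_cons]
        refine sup_le (sup_le ?_ le_sup_left) (hQp.trans le_sup_right)
        rw [Ideal.span_singleton_le_iff_mem]
        exact Ideal.mem_sup_right hbp
      have h3 := h1.trans h2
      rw [hlen, List.length_cons] at h3
      have : bs.length + 1 ≤ bs.length := by exact_mod_cast h3
      omega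
    have : Nontrivial (QuotSMulTop b M) := nontrivial_quotSMulTop_of_mem_maximalIdeal _ hb
    -- `Q` collects the elements already divided out, so that the radical condition survives the
    -- induction.
    refine .cons hreg (ih hbs' (Q := Q ⊔ Ideal.span {b}) ?_ ?_
      (exists_isRegular_quotSMulTop hb hreg h))
    · refine sup_le (hQ.trans (LinearMap.annihilator_le_of_surjective _
        (Submodule.mkQ_surjective _))) ?_
      rw [Ideal.span_singleton_le_iff_mem, Module.mem_annihilator]
      intro z
      obtain ⟨z, rfl⟩ := Submodule.mkQ_surjective _ z
      rw [← map_smul, Submodule.mkQ_apply, Submodule.Quotient.mk_eq_zero]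
      exact Submodule.smul_mem_pointwise_smul _ _ _ trivial
    · rwa [Ideal.ofList_cons, sup_assoc, sup_comm, sup_assoc] at hprim

theorem localDepth_le_ringKrullDim : (localDepth R : WithBot ℕ∞) ≤ ringKrullDim R := by
  have h : localDepth R ≤ (maximalIdeal R).height := by
    refine iSup_le fun ⟨rs, hrs, hmem⟩ => ?_
    have h1 := ringKrullDim_add_length_eq_ringKrullDim_of_isRegular rs hrs
    have : Nontrivial (R ⧸ Ideal.ofList rs) := Ideal.Quotient.nontrivial_iff.mpr fun h =>
      hrs.2 (by rw [h, Submodule.top_smul])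
    have h2 := add_le_add_left (ringKrullDim_nonneg_of_nontrivial (R := R ⧸ Ideal.ofList rs))
      (rs.length : WithBot ℕ∞)
    rw [zero_add, h1, ← IsLocalRing.maximalIdeal_height_eq_ringKrullDim] at h2
    exact_mod_cast h2
  rw [← IsLocalRing.maximalIdeal_height_eq_ringKrullDim]
  exact_mod_cast h

theorem exists_isRegular_length_eq {R : Type u} [CommRing R] [IsLocalRing R] {n : ℕ} (h : (n : ℕ∞) ≤ localDepth R) :
    ∃ rs : List R, rs.length = n ∧ (∀ r ∈ rs, r ∈ maximalIdeal R) ∧ IsRegular R rs := by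
  obtain ⟨rs, hrs, hmem, hlen⟩ : ∃ rs : List R, IsRegular R rs ∧ (∀ r ∈ rs, r ∈ maximalIdeal R) ∧
      n ≤ rs.length := by
    cases n with
    | zero => exact ⟨[], .nil _ _, by simp, by simp⟩
    | succ n =>
      by_contra! H
      refine absurd h (not_le.mpr (lt_of_le_of_lt (b := (n : ℕ∞)) (iSup_le fun ⟨rs, h1, h2⟩ => ?_) ?_))
      · exact_mod_cast Nat.lt_succ_iff.mp (H rs h1 h2)
      · exact_mod_cast Nat.lt_succ_self n
  have hw : IsWeaklyRegular R (rs.take n) := by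
    have := hrs.1
    rw [← List.take_append_drop n rs, isWeaklyRegular_append_iff] at this
    exact this.1
  have hm : ∀ r ∈ rs.take n, r ∈ maximalIdeal R := fun r hr => hmem r (List.mem_of_mem_take hr)
  exact ⟨rs.take n, by simpa using hlen, hm,
    (IsLocalRing.isRegular_iff_isWeaklyRegular_of_subset_maximalIdeal hm).mpr hw⟩

end SystemOfParameters

/-! ### Powers of a weakly regular sequence. -/

section Powers

open RingTheory.Sequence Pointwise

/-- Reduction modulo `r` keeps the short sequence exact on the left because `r` is regular on `M''`.
-/
theorem isWeaklyRegular_of_exact {R : Type*} [CommRing R] {rs : List R}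
    {M' M M'' : Type u} [AddCommGroup M'] [AddCommGroup M] [AddCommGroup M'']
    [Module R M'] [Module R M] [Module R M''] {f : M' →ₗ[R] M} {g : M →ₗ[R] M''}
    (hf : Function.Injective f) (hfg : Function.Exact f g) (hg : Function.Surjective g)
    (h' : IsWeaklyRegular M' rs) (h'' : IsWeaklyRegular M'' rs) : IsWeaklyRegular M rs := by
  induction rs generalizing M' M M'' with
  | nil => exact .nil _ _
  | cons r rs ih =>
    rw [isWeaklyRegular_cons_iff] at h' h'' ⊢
    refine ⟨isSMulRegular_of_range_eq_ker hf hfg.linearMap_ker_eq.symm h'.1 h''.1,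
      ih (f := QuotSMulTop.map r f) (g := QuotSMulTop.map r g) ?_
        (QuotSMulTop.map_exact r hfg hg) (QuotSMulTop.map_surjective r hg) h'.2 h''.2⟩
    have h0 : Function.Exact (0 : M' →ₗ[R] M') f := by
      rw [LinearMap.exact_zero_iff_injective]
      exact hf
    have := QuotSMulTop.map_first_exact_on_four_term_exact_of_isSMulRegular_last h0 hfg h''.1
    rwa [map_zero, LinearMap.exact_zero_iff_injective] at this

theorem isWeaklyRegular_quotSMulTop_pow {R : Type*} [CommRing R] {M : Type u} [AddCommGroup M]
    [Module R M] {r : R} {rs : List R} (hr : IsSMulRegular M r)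
    (h : IsWeaklyRegular (QuotSMulTop r M) rs) (e : ℕ) :
    IsWeaklyRegular (QuotSMulTop (r ^ e) M) rs := by
  induction e with
  | zero =>
    have hsub : Subsingleton (QuotSMulTop (r ^ 0) M) := by
      rw [pow_zero, QuotSMulTop, one_smul]
      exact Submodule.Quotient.subsingleton_iff.mpr rfl
    have : ∀ N : Submodule R (QuotSMulTop (r ^ 0) M), Subsingleton (QuotSMulTop (r ^ 0) M ⧸ N) :=
      fun N => inferInstance
    exact ⟨fun i hi => fun x y _ => Subsingleton.elim _ _⟩
  | succ e ih =>
    -- The induction runs along `0 → M / r ^ e M → M / r ^ (e + 1) M → M / r M → 0`, the first map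
    -- being multiplication by `r`.
    let f : QuotSMulTop (r ^ e) M →ₗ[R] QuotSMulTop (r ^ (e + 1)) M :=
      Submodule.mapQ _ _ (LinearMap.lsmul R M r) <| by
        rintro _ ⟨z, -, rfl⟩
        exact ⟨z, trivial, by simp [pow_succ, mul_smul]⟩
    let g : QuotSMulTop (r ^ (e + 1)) M →ₗ[R] QuotSMulTop r M :=
      Submodule.mapQ _ _ LinearMap.id <| by
        rintro _ ⟨z, -, rfl⟩
        exact ⟨r ^ e • z, trivial, by simp [pow_succ', mul_smul, smul_comm (r ^ e) r]⟩
    have hmem : ∀ (a : R) (z : M), z ∈ a • (⊤ : Submodule R M) ↔ ∃ w, a • w = z := fun a z => by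
      simp [Submodule.mem_smul_pointwise_iff_exists]
    refine isWeaklyRegular_of_exact (f := f) (g := g) ?_ ?_ ?_ ih h
    · rw [injective_iff_map_eq_zero]
      intro z hz
      obtain ⟨z, rfl⟩ := Submodule.mkQ_surjective _ z
      obtain ⟨w, hw⟩ := (hmem _ _).mp ((Submodule.Quotient.mk_eq_zero _).mp hz)
      refine (Submodule.Quotient.mk_eq_zero _).mpr ((hmem _ _).mpr ⟨w, hr ?_⟩)
      simpa [pow_succ', mul_smul] using hw
    · intro z
      obtain ⟨z, rfl⟩ := Submodule.mkQ_surjective _ z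
      constructor
      · intro hz
        obtain ⟨w, hw⟩ := (hmem _ _).mp ((Submodule.Quotient.mk_eq_zero _).mp hz)
        exact ⟨Submodule.mkQ _ w, congrArg (Submodule.mkQ _) hw⟩
      · rintro ⟨w, hw⟩
        obtain ⟨w, rfl⟩ := Submodule.mkQ_surjective _ w
        rw [← hw]
        exact (Submodule.Quotient.mk_eq_zero _).mpr ((hmem _ _).mpr ⟨w, rfl⟩)
    · intro z
      obtain ⟨z, rfl⟩ := Submodule.mkQ_surjective _ z
      exact ⟨Submodule.mkQ _ z, rfl⟩

/-- Powers of a weakly regular sequence form a weakly regular sequence. -/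
theorem isWeaklyRegular_map_pow {R : Type*} [CommRing R] {M : Type u} [AddCommGroup M]
    [Module R M] {rs : List R} (h : IsWeaklyRegular M rs) (e : ℕ) :
    IsWeaklyRegular M (rs.map (· ^ e)) := by
  induction rs generalizing M with
  | nil => exact .nil _ _
  | cons r rs ih =>
    rw [isWeaklyRegular_cons_iff] at h
    rw [List.map_cons, isWeaklyRegular_cons_iff]
    exact ⟨h.1.pow e, isWeaklyRegular_quotSMulTop_pow (h.1) (ih h.2) e⟩

end Powers

/-! ### Weak regularity as ideal membership. -/

section RegularFamily

open RingTheory.Sequence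

variable {S : Type*} [CommRing S]

/-- Weak regularity on the ring of `g 0, …, g (ℓ - 1)`, in terms of ideal membership. -/
def IsRegularFamily (g : ℕ → S) (ℓ : ℕ) : Prop :=
  ∀ s < ℓ, ∀ x, g s * x ∈ Ideal.span (g '' Set.Iio s) → x ∈ Ideal.span (g '' Set.Iio s)

theorem isWeaklyRegular_map_range_iff {g : ℕ → S} {ℓ : ℕ} :
    IsWeaklyRegular S ((List.range ℓ).map g) ↔ IsRegularFamily g ℓ := by
  have hspan : ∀ s ≤ ℓ, Ideal.ofList (((List.range ℓ).map g).take s) • (⊤ : Submodule S S) =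
      Ideal.span (g '' Set.Iio s) := fun s hs => by
    rw [← List.map_take, List.take_range, min_eq_left hs, smul_eq_mul, Ideal.mul_top, Ideal.ofList]
    congr 1
    ext x
    simp
  rw [isWeaklyRegular_iff, IsRegularFamily]
  simp only [isSMulRegular_quotient_iff_mem_of_smul_mem, List.length_map, List.length_range,
    List.getElem_map, List.getElem_range, smul_eq_mul]
  refine forall₂_congr fun s hs => ?_
  have := hspan s hs.le
  rw [smul_eq_mul] at this
  rw [this]

theorem IsRegularFamily.pow {g : ℕ → S} {ℓ : ℕ} (h : IsRegularFamily g ℓ) (e : ℕ) :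
    IsRegularFamily (fun i => g i ^ e) ℓ := by
  rw [← isWeaklyRegular_map_range_iff] at h ⊢
  simpa [Function.comp_def] using isWeaklyRegular_map_pow h e

theorem mem_span_image_Iio_iff {g : ℕ → S} {s : ℕ} {x : S} :
    x ∈ Ideal.span (g '' Set.Iio s) ↔ ∃ y : ℕ → S, x = ∑ i ∈ Finset.range s, g i * y i := by
  constructor
  · intro hx
    refine Submodule.span_induction (p := fun x _ => ∃ y : ℕ → S, x = ∑ i ∈ Finset.range s, g i * y i)
      ?_ ⟨0, by simp⟩ ?_ ?_ hx
    · rintro _ ⟨i, hi, rfl⟩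
      exact ⟨Pi.single i 1, by
        rw [Finset.sum_eq_single i] <;> simp +contextual [show i < s from hi]⟩
    · rintro _ _ - - ⟨y, rfl⟩ ⟨z, rfl⟩
      exact ⟨y + z, by simp [mul_add, Finset.sum_add_distrib]⟩
    · rintro c _ - ⟨y, rfl⟩
      exact ⟨fun i => c * y i, by
        rw [smul_eq_mul, Finset.mul_sum]; exact Finset.sum_congr rfl fun i _ => by ring⟩
  · rintro ⟨y, rfl⟩
    exact Ideal.sum_mem _ fun i hi => Ideal.mul_mem_right _ _
      (Ideal.subset_span ⟨i, Finset.mem_range.mp hi, rfl⟩)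

end RegularFamily

/-! ### Regularity from leading forms in a graded ring. -/

section Filtered

variable {S : Type*} [CommRing S]

/-- Additive endomorphisms of a commutative ring. -/
abbrev AddEnd (S : Type*) [CommRing S] : Type _ := S →+ S

/-- The projections onto the homogeneous components of an `ℕ`-grading of an additive group. -/
structure IsGradedProj (pr : ℕ → AddEnd S) : Prop where
  proj_self : ∀ k x, pr k (pr k x) = pr k x
  proj_ne : ∀ j k x, j ≠ k → pr j (pr k x) = 0
  bounded : ∀ x, ∃ l, ∀ k, l ≤ k → pr k x = 0
  ext_zero : ∀ x, (∀ k, pr k x = 0) → x = 0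

/-- Multiplication by `h` raises degrees by `e`. -/
structure IsHomogeneousElem (pr : ℕ → AddEnd S) (e : ℕ) (h : S) : Prop where
  proj_add : ∀ k x, pr (k + e) (h * x) = h * pr k x
  proj_lt : ∀ k x, k < e → pr k (h * x) = 0

/-- The elements of degree less than `l`. -/
def degreeLT (pr : ℕ → AddEnd S) (l : ℕ) : AddSubgroup S where
  carrier := {x | ∀ k, l ≤ k → pr k x = 0}
  add_mem' hx hy k hk := by rw [map_add, hx k hk, hy k hk, add_zero]
  zero_mem' k _ := map_zero _
  neg_mem' hx k hk := by rw [map_neg, hx k hk, neg_zero]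

variable {pr : ℕ → AddEnd S} {e : ℕ} {g h : ℕ → S}

theorem degreeLT_mono {l m : ℕ} (hlm : l ≤ m) : degreeLT pr l ≤ degreeLT pr m :=
  fun _ hx k hk => hx k (hlm.trans hk)

theorem IsHomogeneousElem.mul_mem {a x : S} {l : ℕ} (ha : IsHomogeneousElem pr e a)
    (hx : x ∈ degreeLT pr l) : a * x ∈ degreeLT pr (l + e) := fun k hk => by
  obtain ⟨m, rfl⟩ := Nat.exists_eq_add_of_le' (le_of_add_le_right hk)
  rw [ha.proj_add, hx m (by omega), mul_zero]

/-- The hypothesis on `b - a` expresses that `b` has leading form `a` of degree `e`, in terms of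
multiplication only. -/
theorem mul_mem_degreeLT {a b x : S} {l : ℕ} (ha : IsHomogeneousElem pr e a)
    (hb : ∀ l, ∀ x ∈ degreeLT pr (l + 1), (b - a) * x ∈ degreeLT pr (l + e))
    (hx : x ∈ degreeLT pr (l + 1)) : b * x ∈ degreeLT pr (l + 1 + e) := by
  have := add_mem (degreeLT_mono (by omega) (hb l x hx)) (ha.mul_mem hx)
  rwa [← add_mul, sub_add_cancel] at this

theorem proj_mul_of_mem_degreeLT {a b x : S} {l : ℕ} (ha : IsHomogeneousElem pr e a)
    (hb : ∀ l, ∀ x ∈ degreeLT pr (l + 1), (b - a) * x ∈ degreeLT pr (l + e))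
    (hx : x ∈ degreeLT pr (l + 1)) : pr (l + e) (b * x) = a * pr l x := by
  rw [← ha.proj_add, ← sub_eq_zero, ← map_sub, ← sub_mul]
  exact hb l x hx _ le_rfl

theorem IsGradedProj.eq_zero (hpr : IsGradedProj pr) {x : S} (hx : x ∈ degreeLT pr 0) : x = 0 :=
  hpr.ext_zero x fun k => hx k (Nat.zero_le k)

theorem IsGradedProj.proj_mem (hpr : IsGradedProj pr) (l : ℕ) (x : S) :
    pr l x ∈ degreeLT pr (l + 1) := fun k hk => hpr.proj_ne k l x (by omega)

theorem IsGradedProj.mem_of_forall_proj_mem (hpr : IsGradedProj pr) {A : AddSubgroup S} {x : S}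
    (hx : ∀ k, pr k x ∈ A) : x ∈ A := by
  obtain ⟨l, hl⟩ := hpr.bounded x
  have : x - ∑ k ∈ Finset.range l, pr k x = 0 := hpr.ext_zero _ fun j => by
    rw [map_sub, map_sum]
    rcases lt_or_ge j l with hj | hj
    · rw [Finset.sum_eq_single_of_mem j (Finset.mem_range.mpr hj) fun k _ hk =>
        hpr.proj_ne j k x hk.symm, hpr.proj_self, sub_self]
    · rw [hl j hj, zero_sub, neg_eq_zero]
      exact Finset.sum_eq_zero fun k hk => hpr.proj_ne j k x (by have := Finset.mem_range.mp hk; omega)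
  rw [sub_eq_zero.mp this]
  exact sum_mem fun k _ => hx k

theorem IsHomogeneousElem.one : IsHomogeneousElem pr 0 1 :=
  ⟨fun k x => by simp, fun k x hk => absurd hk (Nat.not_lt_zero k)⟩

theorem IsHomogeneousElem.mul {a b : S} {m n : ℕ} (ha : IsHomogeneousElem pr m a)
    (hb : IsHomogeneousElem pr n b) : IsHomogeneousElem pr (m + n) (a * b) := by
  refine ⟨fun k x => ?_, fun k x hk => ?_⟩
  · rw [mul_assoc, show k + (m + n) = k + n + m by ring, ha.proj_add, hb.proj_add, mul_assoc]
  · rw [mul_assoc]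
    rcases lt_or_ge k m with hkm | hkm
    · exact ha.proj_lt _ _ hkm
    · obtain ⟨j, rfl⟩ := Nat.exists_eq_add_of_le' hkm
      rw [ha.proj_add, hb.proj_lt _ _ (by omega), mul_zero]

theorem IsHomogeneousElem.pow {a : S} (ha : IsHomogeneousElem pr 1 a) (k : ℕ) :
    IsHomogeneousElem pr k (a ^ k) := by
  induction k with
  | zero => simpa using IsHomogeneousElem.one
  | succ k ih => simpa [pow_succ] using ih.mul ha

/-- The lower terms of a monic polynomial in a form of degree one. -/
theorem aeval_sub_pow_mul_mem {R : Type*} [CommRing R] [Algebra R S]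
    (hR : ∀ c : R, IsHomogeneousElem pr 0 (algebraMap R S c)) {a : S}
    (ha : IsHomogeneousElem pr 1 a) {p : R[X]} (hp : p.Monic) (he : p.natDegree = e) (l : ℕ) {x : S}
    (hx : x ∈ degreeLT pr (l + 1)) : (aeval a p - a ^ e) * x ∈ degreeLT pr (l + e) := by
  rw [hp.as_sum, he, map_add, map_pow, aeval_X, add_sub_cancel_left, map_sum, Finset.sum_mul]
  refine sum_mem fun k hk => ?_
  have hk := Finset.mem_range.mp hk
  rw [map_mul, map_pow, aeval_X, aeval_C]
  refine degreeLT_mono ?_ (((hR _).mul (ha.pow k)).mul_mem hx)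
  omega

/-- If the leading form of `x` in degree `l` lies in the ideal of the leading forms `h`, then `x`
can be reduced to lower degree by the `g`. -/
theorem exists_reduction_of_proj_mem (hpr : IsGradedProj pr) {s : ℕ}
    (hh : ∀ i < s, IsHomogeneousElem pr e (h i))
    (hg : ∀ i < s, ∀ l, ∀ x ∈ degreeLT pr (l + 1), (g i - h i) * x ∈ degreeLT pr (l + e))
    {l : ℕ} {x : S} (hx : x ∈ degreeLT pr (l + 1))
    (hmem : pr l x ∈ Ideal.span (h '' Set.Iio s)) :
    ∃ z : ℕ → S, x - ∑ i ∈ Finset.range s, g i * z i ∈ degreeLT pr l := by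
  obtain ⟨w, hw⟩ := mem_span_image_Iio_iff.mp hmem
  have hstep : ∀ {v : S}, v ∈ degreeLT pr (l + 1) → pr l v = 0 → v ∈ degreeLT pr l :=
    fun hv h0 k hk => by
      rcases hk.eq_or_lt with rfl | hk
      · exact h0
      · exact hv k hk
  -- Below degree `e` the ideal of the `h i` has no nonzero component, so there is nothing to
  -- subtract.
  rcases lt_or_ge l e with hle | hle
  · refine ⟨0, ?_⟩
    simp only [Pi.zero_apply, mul_zero, Finset.sum_const_zero, sub_zero]
    refine hstep hx ?_
    rw [← hpr.proj_self, hw, map_sum]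
    exact Finset.sum_eq_zero fun i hi => (hh i (Finset.mem_range.mp hi)).proj_lt _ _ hle
  · obtain ⟨m, rfl⟩ := Nat.exists_eq_add_of_le' hle
    refine ⟨fun i => pr m (w i), hstep ?_ ?_⟩
    · refine sub_mem hx (sum_mem fun i hi => ?_)
      have hi := Finset.mem_range.mp hi
      exact degreeLT_mono (by omega) (mul_mem_degreeLT (hh i hi) (hg i hi) (hpr.proj_mem m (w i)))
    · rw [map_sub, map_sum, ← hpr.proj_self, hw, map_sum, ← Finset.sum_sub_distrib]
      refine Finset.sum_eq_zero fun i hi => ?_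
      have hi := Finset.mem_range.mp hi
      rw [(hh i hi).proj_add, proj_mul_of_mem_degreeLT (hh i hi) (hg i hi) (hpr.proj_mem m (w i)),
        hpr.proj_self, sub_self]

theorem mul_mem_degreeLT_add (hpr : IsGradedProj pr) {a b x : S} {l : ℕ}
    (ha : IsHomogeneousElem pr e a)
    (hb : ∀ l, ∀ x ∈ degreeLT pr (l + 1), (b - a) * x ∈ degreeLT pr (l + e))
    (hx : x ∈ degreeLT pr l) : b * x ∈ degreeLT pr (l + e) := by
  cases l with
  | zero =>
    rw [hpr.eq_zero hx, mul_zero]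
    exact zero_mem _
  | succ l => exact mul_mem_degreeLT ha hb hx

/-- If the top degree terms of `∑ g i * z i + g s * v` cancel, then `v` can be reduced. -/
theorem exists_reduction_of_cancel (hpr : IsGradedProj pr) {ℓ : ℕ} (hreg : IsRegularFamily h ℓ)
    (hh : ∀ i < ℓ, IsHomogeneousElem pr e (h i))
    (hg : ∀ i < ℓ, ∀ l, ∀ x ∈ degreeLT pr (l + 1), (g i - h i) * x ∈ degreeLT pr (l + e))
    {s : ℕ} (hs : s < ℓ) {l : ℕ} {z : ℕ → S} (hz : ∀ i < s, z i ∈ degreeLT pr (l + 1))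
    {v : S} (hv : v ∈ degreeLT pr (l + 1))
    (h0 : pr (l + e) (∑ i ∈ Finset.range s, g i * z i + g s * v) = 0) :
    ∃ w : ℕ → S, v - ∑ i ∈ Finset.range s, g i * w i ∈ degreeLT pr l := by
  refine exists_reduction_of_proj_mem hpr (fun i hi => hh i (hi.trans hs))
    (fun i hi => hg i (hi.trans hs)) hv (hreg s hs _ ?_)
  rw [map_add, map_sum, proj_mul_of_mem_degreeLT (hh s hs) (hg s hs) hv] at h0
  rw [← neg_mem_iff, ← eq_neg_of_add_eq_zero_left h0, mem_span_image_Iio_iff]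
  refine ⟨fun i => pr l (z i), Finset.sum_congr rfl fun i hi => ?_⟩
  have hi := Finset.mem_range.mp hi
  exact proj_mul_of_mem_degreeLT (hh i (hi.trans hs)) (hg i (hi.trans hs)) (hz i hi)

/-- An element of the ideal of the `g` of degree less than `j + e` is a combination of the `g`
with coefficients of degree less than `j`. -/
theorem exists_bounded_combination (hpr : IsGradedProj pr) {ℓ : ℕ} (hreg : IsRegularFamily h ℓ)
    (hh : ∀ i < ℓ, IsHomogeneousElem pr e (h i))
    (hg : ∀ i < ℓ, ∀ l, ∀ x ∈ degreeLT pr (l + 1), (g i - h i) * x ∈ degreeLT pr (l + e))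
    {s : ℕ} (hs : s ≤ ℓ) (j : ℕ) (y : ℕ → S)
    (hx : ∑ i ∈ Finset.range s, g i * y i ∈ degreeLT pr (j + e)) :
    ∃ z : ℕ → S, ∑ i ∈ Finset.range s, g i * y i = ∑ i ∈ Finset.range s, g i * z i ∧
      ∀ i < s, z i ∈ degreeLT pr j := by
  induction s generalizing j y with
  | zero => exact ⟨y, rfl, by simp⟩
  | succ s ih =>
    have hmulg : ∀ {j : ℕ} {v : S}, v ∈ degreeLT pr j → g s * v ∈ degreeLT pr (j + e) :=
      mul_mem_degreeLT_add hpr (hh s hs) (hg s hs)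
    -- The degree of the last coefficient `v` is lowered until it is below `j`. While it is too
    -- large, the top terms must cancel, so regularity of the `h` puts the leading form of `v` in
    -- the ideal of the earlier ones; the matching combination of the `g i` is moved from `v` into
    -- the other coefficients.
    have key : ∀ l, ∀ (y : ℕ → S) (v : S), v ∈ degreeLT pr l →
        ∑ i ∈ Finset.range s, g i * y i + g s * v ∈ degreeLT pr (j + e) →
        ∃ (y' : ℕ → S), ∃ v' ∈ degreeLT pr j, ∑ i ∈ Finset.range s, g i * y i + g s * v =
          ∑ i ∈ Finset.range s, g i * y' i + g s * v' := by
      intro l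
      induction l with
      | zero => exact fun y v hv _ => ⟨y, v, degreeLT_mono (Nat.zero_le _) hv, rfl⟩
      | succ l ihl =>
        intro y v hv hx
        rcases le_or_gt (l + 1) j with hlj | hlj
        · exact ⟨y, v, degreeLT_mono hlj hv, rfl⟩
        · have hsum := sub_mem (degreeLT_mono (by omega) hx) (hmulg hv)
          rw [add_sub_cancel_right] at hsum
          obtain ⟨z, hz, hzm⟩ := ih (by omega) (l + 1) y hsum
          obtain ⟨w, hw⟩ := exists_reduction_of_cancel hpr hreg hh hg hs hzm hv
            (hz ▸ hx (l + e) (by omega))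
          have heq : ∑ i ∈ Finset.range s, g i * y i + g s * v =
              ∑ i ∈ Finset.range s, g i * (y i + g s * w i) +
                g s * (v - ∑ i ∈ Finset.range s, g i * w i) := by
            simp_rw [mul_add, mul_sub, Finset.sum_add_distrib, Finset.mul_sum, mul_left_comm (g s)]
            ring
          rw [heq] at hx ⊢
          exact ihl _ _ hw hx
    obtain ⟨l, hl⟩ := hpr.bounded (y s)
    rw [Finset.sum_range_succ] at hx
    obtain ⟨y', v', hv', heq⟩ := key l y (y s) hl hx
    have hsum := sub_mem (heq ▸ hx) (hmulg hv')
    rw [add_sub_cancel_right] at hsum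
    obtain ⟨z, hz, hzm⟩ := ih (by omega) j y' hsum
    refine ⟨Function.update z s v', ?_, fun i hi => ?_⟩
    · rw [Finset.sum_range_succ, Finset.sum_range_succ, heq, hz, Function.update_self]
      congr 1
      refine Finset.sum_congr rfl fun i hi => ?_
      rw [Function.update_of_ne (Finset.mem_range.mp hi).ne]
    · rcases (Nat.lt_succ_iff_lt_or_eq.mp hi) with hi | rfl
      · rw [Function.update_of_ne hi.ne]
        exact hzm i hi
      · rwa [Function.update_self]

/-- A family whose leading forms are a weakly regular family is weakly regular. -/
theorem IsRegularFamily.of_leadingForms (hpr : IsGradedProj pr) {ℓ : ℕ}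
    (hreg : IsRegularFamily h ℓ) (hh : ∀ i < ℓ, IsHomogeneousElem pr e (h i))
    (hg : ∀ i < ℓ, ∀ l, ∀ x ∈ degreeLT pr (l + 1), (g i - h i) * x ∈ degreeLT pr (l + e)) :
    IsRegularFamily g ℓ := by
  intro s hs x hx
  obtain ⟨l, hl⟩ := hpr.bounded x
  change x ∈ degreeLT pr l at hl
  induction l generalizing x with
  | zero =>
    rw [hpr.eq_zero hl]
    exact zero_mem _
  | succ l ihl =>
    obtain ⟨y, hy⟩ := mem_span_image_Iio_iff.mp hx
    obtain ⟨z, hz, hzm⟩ := exists_bounded_combination hpr hreg hh hg hs.le (l + 1) y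
      (hy ▸ mul_mem_degreeLT_add hpr (hh s hs) (hg s hs) hl)
    -- The relation `g s * x = ∑ g i * z i` with bounded `z` is a full cancellation, so `x` drops in
    -- degree modulo the ideal.
    obtain ⟨w, hw⟩ := exists_reduction_of_cancel hpr hreg hh hg hs (z := fun i => -z i)
      (fun i hi => neg_mem (hzm i hi)) hl (by
        simp_rw [mul_neg, Finset.sum_neg_distrib]
        rw [hy, hz, neg_add_cancel, map_zero])
    have hwm : ∑ i ∈ Finset.range s, g i * w i ∈ Ideal.span (g '' Set.Iio s) :=
      mem_span_image_Iio_iff.mpr ⟨w, rfl⟩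
    have := ihl _ (by rw [mul_sub]; exact sub_mem hx (Ideal.mul_mem_left _ _ hwm)) hw
    simpa using add_mem this hwm

end Filtered

/-! ### The grading of `gr_I(R)` and regularity of the initial forms. -/

section AssociatedGraded

variable {R : Type u} [CommRing R] (I : Ideal R)

/-- The associated graded ring, as a type of its own. -/
def GrRing : Type u := AssociatedGradedRing I

noncomputable instance : CommRing (GrRing I) := inferInstanceAs (CommRing (AssociatedGradedRing I))

/-- The quotient map from the Rees algebra to the associated graded ring. -/
noncomputable def grMk : reesAlgebra I →+* GrRing I := Ideal.Quotient.mk (reesShift I)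

noncomputable instance : Algebra R (GrRing I) :=
  ((grMk I).comp (algebraMap R (reesAlgebra I))).toAlgebra

theorem grMk_surjective : Function.Surjective (grMk I) := Ideal.Quotient.mk_surjective

/-- The projection of the Rees algebra onto its component of degree `k`. -/
noncomputable def reesProj (k : ℕ) : reesAlgebra I →+ reesAlgebra I where
  toFun f := ⟨monomial k ((f : R[X]).coeff k), reesAlgebra.monomial_mem.mpr (f.2 k)⟩
  map_zero' := by ext1; simp
  map_add' f g := by ext1; simp

theorem grMk_eq_zero_iff {f : reesAlgebra I} :
    grMk I f = 0 ↔ ∀ n, (f : R[X]).coeff n ∈ I ^ (n + 1) :=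
  Ideal.Quotient.eq_zero_iff_mem

/-- The projection of the associated graded ring onto its component of degree `k`. -/
noncomputable def gradedProj (k : ℕ) : AddEnd (GrRing I) :=
  QuotientAddGroup.lift (reesShift I).toAddSubgroup
    ((grMk I).toAddMonoidHom.comp (reesProj I k)) fun f hf => by
      refine (grMk_eq_zero_iff I).mpr fun n => ?_
      change (monomial k ((f : R[X]).coeff k)).coeff n ∈ _
      rw [coeff_monomial]
      split_ifs with h
      · subst h
        exact hf k
      · exact zero_mem _

theorem gradedProj_grMk (k : ℕ) (f : reesAlgebra I) :
    gradedProj I k (grMk I f) = grMk I (reesProj I k f) :=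
  rfl

theorem isGradedProj_gradedProj : IsGradedProj (gradedProj I) where
  proj_self k x := by
    obtain ⟨f, rfl⟩ := grMk_surjective I x
    rw [gradedProj_grMk, gradedProj_grMk]
    congr 1
    ext1
    simp [reesProj]
  proj_ne j k x hjk := by
    obtain ⟨f, rfl⟩ := grMk_surjective I x
    rw [gradedProj_grMk, gradedProj_grMk, ← map_zero (grMk I)]
    congr 1
    ext1
    simp [reesProj, coeff_monomial, hjk.symm]
  bounded x := by
    obtain ⟨f, rfl⟩ := grMk_surjective I x
    refine ⟨(f : R[X]).natDegree + 1, fun k hk => ?_⟩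
    rw [gradedProj_grMk, ← map_zero (grMk I)]
    congr 1
    ext1
    simp [reesProj, coeff_eq_zero_of_natDegree_lt (show (f : R[X]).natDegree < k by omega)]
  ext_zero x hx := by
    obtain ⟨f, rfl⟩ := grMk_surjective I x
    refine (grMk_eq_zero_iff I).mpr fun n => ?_
    have := (grMk_eq_zero_iff I).mp (hx n) n
    simpa [reesProj] using this

theorem isHomogeneousElem_algebraMap (c : R) :
    IsHomogeneousElem (gradedProj I) 0 (algebraMap R (GrRing I) c) where
  proj_add k x := by
    obtain ⟨f, rfl⟩ := grMk_surjective I x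
    change gradedProj I k (grMk I (algebraMap R (reesAlgebra I) c) *
      grMk I f) = grMk I (algebraMap R (reesAlgebra I) c) * _
    rw [← map_mul, gradedProj_grMk, gradedProj_grMk, ← map_mul]
    congr 1
    ext1
    simp [reesProj, C_mul_monomial]
  proj_lt k x hk := absurd hk (Nat.not_lt_zero k)

/-- The initial form of degree one of an element of `I`. -/
noncomputable def initialForm {a : R} (ha : a ∈ I) : GrRing I :=
  grMk I ⟨monomial 1 a, reesAlgebra.monomial_mem.mpr (by rwa [pow_one])⟩

variable {I} in
/-- The element `x tᵏ` of the Rees algebra. -/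
noncomputable def reesMonomial (k : ℕ) (x : R) (hx : x ∈ I ^ k) : reesAlgebra I :=
  ⟨monomial k x, reesAlgebra.monomial_mem.mpr hx⟩

variable {I} in
theorem initialForm_mul_grMk_reesMonomial {a v : R} {k : ℕ} (ha : a ∈ I) (hv : v ∈ I ^ k) :
    initialForm I ha * grMk I (reesMonomial k v hv) =
      grMk I (reesMonomial (k + 1) (a * v) (mul_mem_pow_succ ha hv)) := by
  rw [initialForm, ← map_mul]
  congr 1
  ext1
  simp [reesMonomial, monomial_mul_monomial, add_comm]

variable {I} in
theorem grMk_reesMonomial_add {x y : R} {k : ℕ} (hx : x ∈ I ^ k) (hy : y ∈ I ^ k) :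
    grMk I (reesMonomial k (x + y) (add_mem hx hy)) =
      grMk I (reesMonomial k x hx) + grMk I (reesMonomial k y hy) := by
  rw [← map_add]
  congr 1
  ext1
  simp [reesMonomial]

variable {I} in
theorem grMk_reesMonomial_smul (c : R) {x : R} {k : ℕ} (hx : x ∈ I ^ k) :
    grMk I (reesMonomial k (c * x) (Ideal.mul_mem_left _ c hx)) =
      c • grMk I (reesMonomial k x hx) := by
  rw [Algebra.smul_def]
  change _ = grMk I (algebraMap R (reesAlgebra I) c) * _
  rw [← map_mul]
  congr 1
  ext1
  simp [reesMonomial, C_mul_monomial]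

theorem isHomogeneousElem_initialForm {a : R} (ha : a ∈ I) :
    IsHomogeneousElem (gradedProj I) 1 (initialForm I ha) where
  proj_add k x := by
    obtain ⟨f, rfl⟩ := grMk_surjective I x
    rw [initialForm, ← map_mul, gradedProj_grMk, gradedProj_grMk, ← map_mul]
    congr 1
    ext1
    simp [reesProj, coeff_monomial_mul, monomial_mul_monomial, add_comm]
  proj_lt k x hk := by
    obtain rfl : k = 0 := by omega
    obtain ⟨f, rfl⟩ := grMk_surjective I x
    rw [initialForm, ← map_mul, gradedProj_grMk, ← map_zero (grMk I)]
    congr 1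
    ext1
    simp [reesProj]

variable {I}

theorem span_image_Iio_succ (b : ℕ → R) (s : ℕ) : Ideal.span (b '' Set.Iio (s + 1)) =
    Ideal.span (b '' Set.Iio s) ⊔ Ideal.span {b s} := by
  rw [← Ideal.span_union, show Set.Iio (s + 1) = Set.Iio s ∪ {s} by ext; simp,
    Set.image_union, Set.image_singleton]

/-- The Valabrega–Valla condition descends to the initial segments of a regular sequence. -/
theorem span_image_Iio_inf_pow_le {b : ℕ → R} (hbI : ∀ i, b i ∈ I) {ℓ : ℕ}
    (hreg : IsRegularFamily b ℓ)
    (hVV : ∀ k, Ideal.span (b '' Set.Iio ℓ) ⊓ I ^ (k + 1) ≤ Ideal.span (b '' Set.Iio ℓ) * I ^ k)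
    {s : ℕ} (hs : s ≤ ℓ) (k : ℕ) :
    Ideal.span (b '' Set.Iio s) ⊓ I ^ (k + 1) ≤ Ideal.span (b '' Set.Iio s) * I ^ k := by
  induction hs using Nat.decreasingInduction generalizing k with
  | self => exact hVV k
  | of_succ s hs ih =>
    induction k with
    | zero => simp
    | succ k ihk =>
      rintro z ⟨hz, hzI⟩
      have hz' := ih (k + 1)
        ⟨Ideal.span_mono (Set.image_mono (Set.Iio_subset_Iio (Nat.le_succ s))) hz, hzI⟩
      rw [span_image_Iio_succ, Ideal.sup_mul] at hz'
      obtain ⟨u, hu, v, hv, rfl⟩ := Submodule.mem_sup.mp hz'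
      obtain ⟨y, hy, rfl⟩ := Ideal.mem_span_singleton_mul.mp hv
      -- Here `y ∈ I ^ (k + 1)`, so regularity of `b s` brings `y` under the hypothesis for `k`; the
      -- factor `b s ∈ I` restores the lost power of `I`.
      have hy' : y ∈ Ideal.span (b '' Set.Iio s) :=
        hreg s hs y ((Ideal.add_mem_iff_right _ (Ideal.mul_le_left hu)).mp hz)
      refine add_mem hu ?_
      rw [pow_succ, ← mul_assoc, mul_comm (b s)]
      exact Ideal.mul_mem_mul (ihk ⟨hy', hy⟩) (hbI s)

/-- The forms of degree `k + 1` with coefficient in `(b 0, …, b (s - 1)) I ^ k` lie in every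
submodule containing the products of the initial forms of the `b i` with the forms of degree `k`. -/
theorem grMk_reesMonomial_mem_of_mem_span_mul {b : ℕ → R} (hbI : ∀ i, b i ∈ I) {s k : ℕ}
    {A : Submodule R (GrRing I)} (hA : ∀ i < s, ∀ v, ∀ hv : v ∈ I ^ k,
      initialForm I (hbI i) * grMk I (reesMonomial k v hv) ∈ A) {w : R}
    (hw : w ∈ Ideal.span (b '' Set.Iio s) * I ^ k) :
    ∃ h : w ∈ I ^ (k + 1), grMk I (reesMonomial (k + 1) w h) ∈ A := by
  induction hw using Submodule.mul_induction_on' with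
  | mem_mul_mem j hj v hv =>
    refine Submodule.span_induction (p := fun j _ => ∃ h : j * v ∈ I ^ (k + 1),
      grMk I (reesMonomial (k + 1) (j * v) h) ∈ A) ?_ ?_ ?_ ?_ hj
    · rintro _ ⟨i, hi, rfl⟩
      refine ⟨mul_mem_pow_succ (hbI i) hv, ?_⟩
      rw [← initialForm_mul_grMk_reesMonomial (hbI i) hv]
      exact hA i hi v hv
    · refine ⟨by simp, ?_⟩
      rw [(grMk_eq_zero_iff I).mpr fun n => by simp [reesMonomial]]
      exact zero_mem _
    · rintro x y - - ⟨h, hx⟩ ⟨h', hy⟩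
      refine ⟨by rw [add_mul]; exact add_mem h h', ?_⟩
      simp only [add_mul, grMk_reesMonomial_add h h']
      exact add_mem hx hy
    · rintro c x - ⟨h, hx⟩
      refine ⟨by rw [smul_eq_mul, mul_assoc]; exact Ideal.mul_mem_left _ _ h, ?_⟩
      simp only [smul_eq_mul, mul_assoc, grMk_reesMonomial_smul c h]
      exact A.smul_mem _ hx
  | add x hx y hy ihx ihy =>
    obtain ⟨h, hx⟩ := ihx
    obtain ⟨h', hy⟩ := ihy
    refine ⟨add_mem h h', ?_⟩
    rw [grMk_reesMonomial_add h h']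
    exact add_mem hx hy

/-- Valabrega–Valla: the initial forms of the generators are a regular sequence. -/
theorem isRegularFamily_initialForm {b : ℕ → R} (hbI : ∀ i, b i ∈ I) {ℓ : ℕ}
    (hreg : IsRegularFamily b ℓ)
    (hVV : ∀ k, Ideal.span (b '' Set.Iio ℓ) ⊓ I ^ (k + 1) ≤ Ideal.span (b '' Set.Iio ℓ) * I ^ k) :
    IsRegularFamily (fun i => initialForm I (hbI i)) ℓ := by
  intro s hs x hx
  obtain ⟨y, hy⟩ := mem_span_image_Iio_iff.mp hx
  obtain ⟨f, rfl⟩ := grMk_surjective I x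
  choose F hF using fun i => grMk_surjective I (y i)
  simp_rw [← hF, initialForm, ← map_mul] at hy
  rw [← map_sum, ← sub_eq_zero, ← map_sub, grMk_eq_zero_iff] at hy
  have hJI : Ideal.span (b '' Set.Iio s) ≤ I := by
    rw [Ideal.span_le]
    rintro _ ⟨i, -, rfl⟩
    exact hbI i
  -- The given relation puts `b s * f_k - ∑ b i * F_i` in `I ^ (k + 2)`, hence in `(b 0, …, b s) I ^
  -- (k + 1)`. The coefficient `e` of `b s` there does not change the form of `f_k`, and `b s * (f_k
  -- - e)` lies in the ideal of the earlier `b i`.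
  have key : ∀ k, ∃ e ∈ I ^ (k + 1), (f : R[X]).coeff k - e ∈ Ideal.span (b '' Set.Iio s) := by
    intro k
    have h1 : b s * (f : R[X]).coeff k - ∑ i ∈ Finset.range s, b i * (F i : R[X]).coeff k ∈
        I ^ (k + 2) := by
      simpa [finsetSum_coeff, coeff_monomial_mul] using hy (k + 1)
    have h2 : ∑ i ∈ Finset.range s, b i * (F i : R[X]).coeff k ∈ Ideal.span (b '' Set.Iio s) :=
      mem_span_image_Iio_iff.mpr ⟨_, rfl⟩
    have h3 : b s * (f : R[X]).coeff k - ∑ i ∈ Finset.range s, b i * (F i : R[X]).coeff k ∈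
        Ideal.span (b '' Set.Iio (s + 1)) := by
      rw [span_image_Iio_succ]
      exact sub_mem (Ideal.mem_sup_right (Ideal.mul_mem_right _ _ (Ideal.mem_span_singleton_self _)))
        (Ideal.mem_sup_left h2)
    have h4 := span_image_Iio_inf_pow_le hbI hreg hVV (Nat.succ_le_of_lt hs) (k + 1) ⟨h3, h1⟩
    rw [span_image_Iio_succ, Ideal.sup_mul] at h4
    obtain ⟨u, hu, v, hv, huv⟩ := Submodule.mem_sup.mp h4
    obtain ⟨e, he, rfl⟩ := Ideal.mem_span_singleton_mul.mp hv
    refine ⟨e, he, hreg s hs _ ?_⟩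
    have h5 := add_mem (Ideal.mul_le_left hu) h2
    convert h5 using 1
    linear_combination -huv
  refine (isGradedProj_gradedProj I).mem_of_forall_proj_mem (A := (Ideal.span _).toAddSubgroup)
    fun k => ?_
  obtain ⟨e, he, hfe⟩ := key k
  rw [gradedProj_grMk]
  cases k with
  | zero =>
    have : grMk I (reesProj I 0 f) = 0 := by
      refine (grMk_eq_zero_iff I).mpr fun n => ?_
      change (monomial 0 ((f : R[X]).coeff 0)).coeff n ∈ _
      rw [coeff_monomial]
      split_ifs with h
      · subst h
        have := add_mem (hJI hfe) (show e ∈ I by simpa using he)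
        simpa using this
      · exact zero_mem _
    rw [this]
    exact zero_mem _
  | succ k =>
    have hmem := span_image_Iio_inf_pow_le hbI hreg hVV hs.le k
      ⟨hfe, sub_mem (f.2 (k + 1)) (Ideal.pow_le_pow_right (Nat.le_succ _) he)⟩
    obtain ⟨h, hspan⟩ := grMk_reesMonomial_mem_of_mem_span_mul hbI
      (A := (Ideal.span ((fun i => initialForm I (hbI i)) '' Set.Iio s)).restrictScalars R)
      (fun i hi v hv => Ideal.mul_mem_right _ _ (Ideal.subset_span ⟨i, hi, rfl⟩)) hmem
    suffices heq : grMk I (reesProj I (k + 1) f) =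
        grMk I (reesMonomial (k + 1) _ h) by
      rw [heq]
      exact hspan
    rw [← sub_eq_zero, ← map_sub, grMk_eq_zero_iff]
    intro n
    change (monomial (k + 1) ((f : R[X]).coeff (k + 1)) -
      monomial (k + 1) ((f : R[X]).coeff (k + 1) - e)).coeff n ∈ _
    rw [← map_sub, sub_sub_cancel, coeff_monomial]
    split_ifs with h
    · subst h
      exact he
    · exact zero_mem _

end AssociatedGraded

/-! ### The dimension of `gr_I(R)`. -/

theorem ringKrullDim_le_of_isIntegral (A B : Type*) [CommRing A] [CommRing B] [Algebra A B]
    [Algebra.IsIntegral A B] : ringKrullDim B ≤ ringKrullDim A := by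
  refine Order.krullDim_le_of_strictMono (PrimeSpectrum.comap (algebraMap A B)) fun P Q hPQ => ?_
  obtain ⟨hle, x, hxQ, hxP⟩ := SetLike.lt_iff_le_and_exists.mp
    (show P.asIdeal < Q.asIdeal from hPQ)
  -- By incomparability, contraction is strictly monotone on primes.
  exact Ideal.comap_lt_comap_of_integral_mem_sdiff hle ⟨hxQ, hxP⟩ (Algebra.IsIntegral.isIntegral x)

section Dimension

variable {R : Type u} [CommRing R] {I : Ideal R}

instance [IsNoetherianRing R] : IsNoetherianRing (GrRing I) :=
  isNoetherianRing_of_surjective _ _ (grMk I) (grMk_surjective I)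

instance [IsNoetherianRing R] : Algebra.FiniteType R (GrRing I) :=
  Algebra.FiniteType.of_surjective (R := R) (A := reesAlgebra I) ⟨grMk I, fun _ => rfl⟩
    (grMk_surjective I)

theorem algebraMap_grRing_eq_zero {a : R} (ha : a ∈ I) : algebraMap R (GrRing I) a = 0 := by
  refine (grMk_eq_zero_iff I).mpr fun n => ?_
  change (C a).coeff n ∈ _
  rw [coeff_C]
  split_ifs with h
  · subst h
    simpa using ha
  · exact zero_mem _

variable (I) in
/-- The inclusion of the forms of degree `k`, as a linear map on `I ^ k`. -/
noncomputable def formMap (k : ℕ) : (I ^ k : Ideal R) →ₗ[R] GrRing I where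
  toFun x := grMk I (reesMonomial k x x.2)
  map_add' x y := grMk_reesMonomial_add x.2 y.2
  map_smul' c x := grMk_reesMonomial_smul c x.2

variable (I) in
/-- The homomorphism from the residue ring of `I` to the associated graded ring. -/
noncomputable def residueMap : R ⧸ I →+* GrRing I :=
  Ideal.Quotient.lift I (algebraMap R (GrRing I)) fun _ ha => algebraMap_grRing_eq_zero ha

/-- The homomorphism from a polynomial ring over `R / I` given by initial forms. -/
noncomputable def polyMap {b : ℕ → R} (hbI : ∀ i, b i ∈ I) (ℓ : ℕ) :
    MvPolynomial (Fin ℓ) (R ⧸ I) →+* GrRing I :=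
  MvPolynomial.eval₂Hom (residueMap I) fun i => initialForm I (hbI i)

/-- The forms of degree at most `m` generate: beyond `m`, each form is a combination of the initial
forms with coefficients one degree lower. -/
theorem finite_polyMap [IsNoetherianRing R] {b : ℕ → R} (hbI : ∀ i, b i ∈ I) {ℓ m : ℕ}
    (hred : ∀ k, m ≤ k → I ^ (k + 1) = Ideal.span (b '' Set.Iio ℓ) * I ^ k) :
    (polyMap hbI ℓ).Finite := by
  let : Algebra (MvPolynomial (Fin ℓ) (R ⧸ I)) (GrRing I) := (polyMap hbI ℓ).toAlgebra
  have htower : IsScalarTower R (MvPolynomial (Fin ℓ) (R ⧸ I)) (GrRing I) :=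
    .of_algebraMap_eq fun r => by
      change _ = polyMap hbI ℓ (MvPolynomial.C (Ideal.Quotient.mk I r))
      rw [polyMap, MvPolynomial.coe_eval₂Hom, MvPolynomial.eval₂_C]
      rfl
  obtain ⟨t, ht⟩ : (⨆ k ∈ Finset.range (m + 1), LinearMap.range (formMap I k)).FG :=
    Submodule.fg_biSup _ _ fun k _ =>
      (LinearMap.range_eq_map (formMap I k)) ▸ (IsNoetherian.noetherian _).map _
  refine ⟨⟨t, ?_⟩⟩
  let W := Submodule.span (MvPolynomial (Fin ℓ) (R ⧸ I)) (t : Set (GrRing I))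
  have hW : ∀ k, LinearMap.range (formMap I k) ≤ W.restrictScalars R := by
    intro k
    induction k with
    | zero =>
      refine le_trans ?_ (Submodule.span_le_restrictScalars R _ (t : Set (GrRing I)))
      rw [ht]
      exact le_biSup (fun k => LinearMap.range (formMap I k)) (by simp)
    | succ k ih =>
      by_cases hk : k + 1 ≤ m
      · refine le_trans ?_ (Submodule.span_le_restrictScalars R _ (t : Set (GrRing I)))
        rw [ht]
        exact le_biSup (fun k => LinearMap.range (formMap I k))
          (Finset.mem_range.mpr (Nat.lt_succ_of_le hk))
      · rintro _ ⟨⟨w, hw⟩, rfl⟩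
        obtain ⟨h, hmem⟩ := grMk_reesMonomial_mem_of_mem_span_mul hbI (s := ℓ) (k := k)
          (A := W.restrictScalars R) (fun i hi v hv => by
            have := W.smul_mem (MvPolynomial.X ⟨i, hi⟩) (ih ⟨⟨v, hv⟩, rfl⟩)
            have hX : algebraMap (MvPolynomial (Fin ℓ) (R ⧸ I)) (GrRing I)
                (MvPolynomial.X ⟨i, hi⟩) = initialForm I (hbI i) := by
              change polyMap hbI ℓ (MvPolynomial.X ⟨i, hi⟩) = _
              rw [polyMap, MvPolynomial.coe_eval₂Hom, MvPolynomial.eval₂_X]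
            rw [Algebra.smul_def, hX] at this
            exact this) (hred k (by omega) ▸ hw)
        exact hmem
  rw [eq_top_iff]
  intro x _
  refine (isGradedProj_gradedProj I).mem_of_forall_proj_mem (A := W.toAddSubgroup) fun k => ?_
  obtain ⟨f, rfl⟩ := grMk_surjective I x
  exact hW k ⟨⟨_, f.2 k⟩, rfl⟩

theorem ringKrullDim_grRing_le [IsNoetherianRing R] [IsArtinianRing (R ⧸ I)] {b : ℕ → R}
    (hbI : ∀ i, b i ∈ I) {ℓ m : ℕ}
    (hred : ∀ k, m ≤ k → I ^ (k + 1) = Ideal.span (b '' Set.Iio ℓ) * I ^ k) :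
    ringKrullDim (GrRing I) ≤ ℓ := by
  let : Algebra (MvPolynomial (Fin ℓ) (R ⧸ I)) (GrRing I) := (polyMap hbI ℓ).toAlgebra
  have : Module.Finite (MvPolynomial (Fin ℓ) (R ⧸ I)) (GrRing I) := finite_polyMap hbI hred
  refine (ringKrullDim_le_of_isIntegral (MvPolynomial (Fin ℓ) (R ⧸ I)) (GrRing I)).trans ?_
  rw [MvPolynomial.ringKrullDim_of_isNoetherianRing]
  have h0 : ringKrullDim (R ⧸ I) ≤ 0 := Order.krullDimLE_iff 0 _ |>.mp inferInstance
  simpa using add_le_add_left h0 (ℓ : WithBot ℕ∞)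

end Dimension

/-! ### Monic polynomials inside arbitrary maximal ideals. -/

section Maximal

variable {R : Type u} [CommRing R] {I : Ideal R}

/-- This is Zariski's lemma over the Jacobson ring `R / I`. -/
theorem isIntegral_quotient_maximal [IsNoetherianRing R] [IsArtinianRing (R ⧸ I)]
    (M : Ideal (GrRing I)) [M.IsMaximal] : Algebra.IsIntegral R (GrRing I ⧸ M) := by
  let := Ideal.Quotient.field M
  let : Algebra (R ⧸ I) (GrRing I ⧸ M) := ((Ideal.Quotient.mk M).comp (residueMap I)).toAlgebra
  have htower : IsScalarTower R (R ⧸ I) (GrRing I ⧸ M) := .of_algebraMap_eq fun _ => rfl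
  have hft : Algebra.FiniteType R (GrRing I ⧸ M) :=
    Algebra.FiniteType.of_surjective (Ideal.Quotient.mkₐ R M) Ideal.Quotient.mk_surjective
  have := Algebra.FiniteType.of_restrictScalars_finiteType R (R ⧸ I) (GrRing I ⧸ M)
  have := finite_of_finite_type_of_isJacobsonRing (R ⧸ I) (GrRing I ⧸ M)
  have : Algebra.IsIntegral R (R ⧸ I) := .of_surjective (Ideal.Quotient.mkₐ R I) Ideal.Quotient.mk_surjective
  exact Algebra.IsIntegral.trans (R ⧸ I)

/-- Every maximal ideal contains monic polynomials of a common degree in given elements. -/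
theorem exists_monic_aeval_mem [IsNoetherianRing R] [IsArtinianRing (R ⧸ I)]
    (M : Ideal (GrRing I)) [M.IsMaximal] (T : ℕ → GrRing I) (ℓ : ℕ) :
    ∃ (e : ℕ) (p : ℕ → R[X]), ∀ i < ℓ, (p i).Monic ∧ (p i).natDegree = e ∧ aeval (T i) (p i) ∈ M := by
  have := isIntegral_quotient_maximal M
  choose q hq hq0 using fun i => Algebra.IsIntegral.isIntegral (R := R) (Ideal.Quotient.mk M (T i))
  cases subsingleton_or_nontrivial R
  · exact ⟨0, q, fun i _ => ⟨hq i, by simp [Subsingleton.elim (q i) 0], by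
      simp [Subsingleton.elim (q i) 0]⟩⟩
  -- The sum bounds every degree, and factors `X ^ (e - deg)` bring all polynomials to degree `e`
  -- without leaving `M`.
  · let e := ∑ i ∈ Finset.range ℓ, (q i).natDegree
    refine ⟨e, fun i => q i * X ^ (e - (q i).natDegree), fun i hi => ⟨(hq i).mul (monic_X_pow _), ?_, ?_⟩⟩
    · have : (q i).natDegree ≤ e := Finset.single_le_sum (f := fun i => (q i).natDegree)
        (fun _ _ => Nat.zero_le _) (Finset.mem_range.mpr hi)
      rw [(hq i).natDegree_mul (monic_X_pow _), natDegree_X_pow]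
      omega
    · rw [map_mul]
      refine Ideal.mul_mem_right _ _ ?_
      rw [← Ideal.Quotient.eq_zero_iff_mem, ← Ideal.Quotient.mkₐ_eq_mk R, ← aeval_algHom_apply]
      exact hq0 i

end Maximal

/-! ### Assembly of depth and dimension. -/

section Main

variable {R : Type u} [CommRing R]

/-- The associated graded ring is Cohen–Macaulay if the Valabrega–Valla condition holds for a
reduction generated by a regular sequence. -/
theorem isCohenMacaulayRing_grRing [IsNoetherianRing R] {I : Ideal R} [IsArtinianRing (R ⧸ I)]
    {b : ℕ → R} (hbI : ∀ i, b i ∈ I) {ℓ m : ℕ} (hreg : IsRegularFamily b ℓ)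
    (hVV : ∀ k, Ideal.span (b '' Set.Iio ℓ) ⊓ I ^ (k + 1) ≤ Ideal.span (b '' Set.Iio ℓ) * I ^ k)
    (hred : ∀ k, m ≤ k → I ^ (k + 1) = Ideal.span (b '' Set.Iio ℓ) * I ^ k) :
    IsCohenMacaulayRing (GrRing I) := by
  refine ⟨inferInstance, fun M _ => ?_⟩
  have hnoeth : IsNoetherianRing (Localization.AtPrime M) :=
    IsLocalization.isNoetherianRing M.primeCompl _ inferInstance
  refine ⟨hnoeth, le_antisymm localDepth_le_ringKrullDim ?_⟩
  obtain ⟨e, p, hp⟩ := exists_monic_aeval_mem M (fun i => initialForm I (hbI i)) ℓ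
  have hfam : IsRegularFamily (fun i => aeval (initialForm I (hbI i)) (p i)) ℓ :=
    .of_leadingForms (isGradedProj_gradedProj I)
      ((isRegularFamily_initialForm hbI hreg hVV).pow e)
      (fun i _ => (isHomogeneousElem_initialForm I (hbI i)).pow e)
      fun i hi l x hx => aeval_sub_pow_mul_mem (isHomogeneousElem_algebraMap I)
        (isHomogeneousElem_initialForm I (hbI i)) (hp i hi).1 (hp i hi).2.1 l hx
  have hmem : ∀ r ∈ (List.range ℓ).map fun i => aeval (initialForm I (hbI i)) (p i), r ∈ M := by
    intro r hr
    obtain ⟨i, hi, rfl⟩ := List.mem_map.mp hr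
    exact (hp i (List.mem_range.mp hi)).2.2
  have hloc := (isWeaklyRegular_map_range_iff.mpr hfam).isRegular_of_isLocalization_of_mem
    (Localization.AtPrime M) M hmem
  have hdepth : (ℓ : ℕ∞) ≤ localDepth (Localization.AtPrime M) := by
    refine le_iSup_of_le ⟨_, hloc, fun r hr => ?_⟩ (by simp)
    obtain ⟨a, ha, rfl⟩ := List.mem_map.mp hr
    exact (IsLocalization.AtPrime.to_map_mem_maximal_iff _ M a).mpr (hmem a ha)
  calc ringKrullDim (Localization.AtPrime M) = M.height :=
        IsLocalization.AtPrime.ringKrullDim_eq_height M _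
    _ ≤ ringKrullDim (GrRing I) := Ideal.height_le_ringKrullDim_of_isPrime
    _ ≤ ((ℓ : ℕ∞) : WithBot ℕ∞) := ringKrullDim_grRing_le hbI hred
    _ ≤ (localDepth (Localization.AtPrime M) : WithBot ℕ∞) := by exact_mod_cast hdepth

variable [IsLocalRing R]

theorem isArtinianRing_quotient_of_isMPrimary [IsNoetherianRing R] {I : Ideal R}
    (hI : IsMPrimary I) : IsArtinianRing (R ⧸ I) := by
  refine IsLocalRing.quotient_artinian_of_mem_minimalPrimes_of_isLocalRing I
    ⟨⟨inferInstance, hI.2 ▸ Ideal.le_radical⟩, fun q hq _ => ?_⟩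
  rw [← hI.2]
  exact hq.1.radical_le_iff.mpr hq.2

/-- In a Cohen–Macaulay local ring a minimal reduction of an ideal primary to the maximal ideal is
generated by a regular sequence. -/
theorem exists_isRegularFamily_of_isMinimalReduction (hCM : IsCohenMacaulayLocalRing R)
    [Infinite (ResidueField R)] {d : ℕ} (hdim : ringKrullDim R = d) {I J : Ideal R}
    (hI : IsMPrimary I) (hJ : IsMinimalReduction I J) :
    ∃ (ℓ : ℕ) (b : ℕ → R), (∀ i, b i ∈ J) ∧ Ideal.span (b '' Set.Iio ℓ) = J ∧
      IsRegularFamily b ℓ := by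
  have := hCM.isNoetherianRing
  obtain ⟨hJI, r, hr⟩ := hJ.1
  have hIm : I ≤ maximalIdeal R := hI.2 ▸ Ideal.le_radical
  have hrad : maximalIdeal R ≤ J.radical := by
    rw [← hI.2, Ideal.radical_le_radical_iff]
    exact fun x hx => ⟨r + 1, Ideal.mul_le_left (hr ▸ Ideal.pow_mem_pow hx (r + 1))⟩
  obtain ⟨N, hN⟩ := Ideal.exists_pow_le_of_le_radical_of_fg hrad (IsNoetherian.noetherian _)
  have hle := spanFinrank_le_of_isMinimalReduction hdim hJ (hJI.trans hIm) hN
  obtain ⟨S, hScard, hS⟩ := Submodule.FG.exists_span_finset_card_eq_spanFinrank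
    (IsNoetherian.noetherian J)
  have hSJ : ∀ x : S, (x : R) ∈ J := fun x => hS ▸ Submodule.subset_span x.2
  -- The value `0` beyond `S.card` keeps every `b i` in `J`.
  let b : ℕ → R := fun i => if h : i < S.card then S.equivFin.symm ⟨i, h⟩ else 0
  have hbJ : ∀ i, b i ∈ J := fun i => by
    dsimp only [b]
    split_ifs
    · exact hSJ _
    · exact zero_mem _
  have hspan : Ideal.span (b '' Set.Iio S.card) = J := by
    refine le_antisymm (Ideal.span_le.mpr ?_) ?_
    · rintro _ ⟨i, -, rfl⟩
      exact hbJ i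
    · rw [← hS]
      refine Submodule.span_le.mpr fun x hx => Ideal.subset_span ?_
      exact ⟨S.equivFin ⟨x, hx⟩, (S.equivFin ⟨x, hx⟩).2, by simp [b]⟩
  refine ⟨S.card, b, hbJ, hspan, isWeaklyRegular_map_range_iff.mp ?_⟩
  refine isWeaklyRegular_of_le_radical (Q := ⊥) ?_ bot_le ?_ ?_
  · intro x hx
    obtain ⟨i, -, rfl⟩ := List.mem_map.mp hx
    exact hIm (hJI (hbJ i))
  · rw [sup_bot_eq]
    convert hrad
    rw [← hspan, Ideal.ofList]
    congr 1
    ext x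
    simp
  · refine exists_isRegular_length_eq ?_
    have h1 := hCM.depth_eq_dim
    rw [hdim] at h1
    have h2 : localDepth R = d := by exact_mod_cast h1
    rw [h2, List.length_map, List.length_range, hScard]
    exact_mod_cast hle

end Main

end SallyModule

theorem theorem3p4 {R : Type u} [CommRing R] [IsLocalRing R]
    (hCM : SallyModule.IsCohenMacaulayLocalRing R)
    (d : ℕ) (hd : 0 < d) (hdim : ringKrullDim R = d)
    (hinf : Infinite (IsLocalRing.ResidueField R))
    (I J : Ideal R) (hI : SallyModule.IsMPrimary I) (hJ : SallyModule.IsMinimalReduction I J)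
    (n : ℕ) (hn : 1 ≤ n)
    (hlen : Module.length R (SallyModule.idealQuot (I ^ (n + 1)) (J * I ^ n)) = 1)
    (ha : ∀ k : ℕ, 1 ≤ k → k ≤ n → J ⊓ I ^ k = J * I ^ (k - 1))
    (hb : 2 ≤ SallyModule.colonQuotDim I J n hlen) :
    SallyModule.IsCohenMacaulayRing (SallyModule.AssociatedGradedRing I) := by
  have := hCM.isNoetherianRing
  have := SallyModule.isArtinianRing_quotient_of_isMPrimary hI
  have hJI : J ≤ I := hJ.1.1
  obtain ⟨ℓ, b, hbJ, rfl, hreg⟩ :=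
    SallyModule.exists_isRegularFamily_of_isMinimalReduction hCM hdim hI hJ
  exact SallyModule.isCohenMacaulayRing_grRing (fun i => hJI (hbJ i)) hreg
    (SallyModule.inf_pow_succ_le hJI hlen ha hb)
    fun k hk => SallyModule.pow_succ_eq_of_le
      (SallyModule.pow_add_two_eq_of_length_eq_one hJI hlen hb) hk
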